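/- **Conventions.** $\mathbb N=\{0,1,2,\dots\}$; $\imath$ is the imaginary unit; $|x|\in\{0,1\}$ is the parity of a homogeneous element, and sign rules are extended bilinearly. Let $K\subseteq\mathbb C$ be a subfield (for instance $K=\mathbb R$ or $K=\mathbb C$), let $\alpha\in K$, $\alpha\neq 0$, and suppose that either $\lambda=\alpha$ and $\alpha\notin\mathbb N$, or $\lambda=1$ and $\alpha^{-1}\notin\mathbb N$. **The Lie superalgebra.** $D_\alpha$ is the Jordan superalgebra with even basis $e_1,e_2$, odd basis $\xi,\eta$, and supercommutative product $e_i^2=e_i$, $e_1e_2=0$, $e_i\xi=\tfrac12\xi$, $e_i\eta=\tfrac12\eta$, $\xi\eta=e_1+\alpha e_2$; its unit is $e_1+e_2$. Let $L_x$ be left multiplication by $x$, $[A,B]=AB-(-1)^{|A||B|}BA$ for endomorphisms, $\mathrm{Der}(D_\alpha)=\{D : [D,L_x]=L_{D(x)}\ \forall x\}$ and $\mathfrak{str}(D_\alpha)=\{L_x\}\oplus\mathrm{Der}(D_\alpha)$. The Lie superalgebra $D(2,1;\alpha)$ is $$\mathfrak g=D_\alpha^-\oplus\mathfrak{str}(D_\alpha)\oplus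 D_\alpha^+$$ over $K$ ($D_\alpha^\pm$ are copies of $D_\alpha$), where $\mathfrak{str}(D_\alpha)$ is a subalgebra and, for $x,y\in D_\alpha^+$, $u,v\in D_\alpha^-$, $I\in\mathrm{Der}(D_\alpha)$, one has $[L_a,x]=ax$, $[I,x]=Ix$, $[L_a,u]=-au$, $[I,u]=Iu$, $[x,u]=2L_{xu}+2[L_x,L_u]$, $[x,y]=0=[u,v]$. Put $\mathfrak k=\{(a,I,-a): a\in D_\alpha,\ I\in\mathrm{Der}(D_\alpha)\}$ and $\mathfrak k_0=\mathfrak k\cap\mathfrak{str}(D_\alpha)=\mathrm{Der}(D_\alpha)$. Let $e,f$ be the units of $D_\alpha^+,D_\alpha^-$ and let $c=\exp(\tfrac{\imath}{2}\mathrm{ad} f)\exp(\imath\,\mathrm{ad}\, e)$ be the Cayley transform of $\mathfrak g_{\mathbb C}$. **The Fock representation.** Let $\mathcal P=\mathcal P(\mathbb C^{2|2})=\mathbb C[z_1,z_2]\otimes\Lambda(z_3,z_4)$ with $z_1,z_2$ even and $z_3,z_4$ odd, let $\partial_i=\partial/\partial z_i$, and let \begin{align*} \mathcal B_1&=(-\lambda+z_1\partial_1+z_3\partial_3+z_4\partial_4)\partial_1-2\alpha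 z_2\partial_3\partial_4,\\ \mathcal B_2&=(-\tfrac{\lambda}{\alpha}+z_2\partial_2+z_3\partial_3+z_4\partial_4)\partial_2-2z_1\partial_3\partial_4,\\ \mathcal B_3&=(-2\lambda+2z_1\partial_1+2\alpha z_2\partial_2+2(1+\alpha)z_3\partial_3)\partial_4+z_3\partial_1\partial_2,\\ \mathcal B_4&=(2\lambda-2z_1\partial_1-2\alpha z_2\partial_2-2(1+\alpha)z_4\partial_4)\partial_3+z_4\partial_1\partial_2 . \end{align*} Write $(x_1,x_2,x_3,x_4)$ for the coordinates of $x\in D_\alpha$ in the basis $e_1,e_2,\xi,\eta$, and let $f_1,\dots,f_4$ be this basis regarded in $D_\alpha^-$. The representation $\pi_\lambda$ of $\mathfrak g_{\mathbb C}$ on $\mathcal P$ is given by $\pi_\lambda(u)=-2\imath\sum_i u_iz_i$ for $u\in D_\alpha^-$, by $\pi_\lambda(x)=-\tfrac{\imath}{2}\sum_i x_i\mathcal B_i$ for $x\in D_\alpha^+$, and by $\pi_\lambda(T)=\lambda(T)+\sum_j [T,f_j]\,\partial_j$ for $T\in\mathfrak{str}(D_\alpha)$, where $[T,f_j]\in D_\alpha^-$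 is read as a linear form in $z_1,\dots,z_4$ via $f_i\leftrightarrow z_i$, and $\lambda(\cdot)$ is the character with $\lambda(2L_{e_1})=\lambda$, $\lambda(2L_{e_2})=\lambda/\alpha$, vanishing on $L_\xi,L_\eta$ and $\mathrm{Der}(D_\alpha)$. The Fock representation is $\rho_\lambda=\pi_\lambda\circ c$. Let $\mathcal I_\lambda=\mathcal P V_\lambda$ with $$V_\alpha=\langle 2z_1z_2+z_3z_4,\ z_2^2,\ z_2z_3,\ z_2z_4\rangle,\qquad V_1=\langle 2\alpha z_1z_2+z_3z_4,\ z_1^2,\ z_1z_3,\ z_1z_4\rangle,$$ and $F_\lambda=U(\mathfrak g)1\bmod\mathcal I_\lambda$, where $U(\mathfrak g)$ acts through $\rho_\lambda$ and complex spans are taken. Set $i=1$ if $\lambda=\alpha$ and $i=2$ if $\lambda=1$, and define subspaces of $\mathcal P/\mathcal I_\lambda$ by $F_{\lambda,0}=\mathbb C$ and, for $k\ge1$, \begin{align*} F_{\lambda,k}&=(\mathbb Cz_1\oplus\mathbb Cz_2\oplus\mathbb Cz_3\oplus\mathbb Cz_4)z_i^{k-1},\\ H_{\alpha,k}&=(\mathbb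 C(z_1+(k-1-\alpha)z_2)\oplus\mathbb Cz_3\oplus\mathbb Cz_4)z_1^{k-1},\\ H_{1,k}&=(\mathbb C(z_2+(k-1-\alpha^{-1})z_1)\oplus\mathbb Cz_3\oplus\mathbb Cz_4)z_2^{k-1}. \end{align*} Irreducibility and indecomposability of supermodules refer to complex subspaces, and are asserted even with respect to invariant subspaces that are not assumed to be $\mathbb Z_2$-graded; non-irreducibility in (1)(b) is asserted in the form that there is a graded proper nonzero submodule. **Theorem (Decomposition of $F$).** $\mathfrak g$ is closed under the bracket, $\rho_\lambda$ is a representation of $\mathfrak g$ on $\mathcal P$, and $\mathcal I_\lambda$ is a submodule, so that $\mathfrak g$ acts on $\mathcal P/\mathcal I_\lambda$. Moreover: 1. (a) If $\alpha\ne-1$, then for every $k\ge1$ an explicit decomposition of $F_{\lambda,k}$ into irreducible $\mathfrak k_0$-modules is $$F_{\lambda,k}=H_{\lambda,k}\oplus\mathbb C(z_1+z_2)^k .$$ (b) If $\alpha=-1$, then for every $k\ge1$ the $\mathfrak k_0$-module $F_{\lambda,k}$ is indecomposable but not irreducible. 2. For every $k\ge0$, $F_{\lambda,k}$ is an irreducible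 $\mathfrak k$-module. 3. $F_\lambda=\mathcal P/\mathcal I_\lambda$, it is an irreducible $\mathfrak g$-module, and its $\mathfrak k$-type decomposition is $$F_\lambda=\bigoplus_{k=0}^\infty F_{\lambda,k}.$$ -/

import Mathlib

noncomputable section

namespace FockD

open scoped Matrix

/-! ## The superalgebra of polynomials on `ℂ^{2|2}` -/

/-- The superalgebra `𝒫(ℂ^{2|2}) = ℂ[z₁, z₂] ⊗ Λ(z₃, z₄)`: the tuple `(a, b, c, d)` stands for
`a + b z₃ + c z₄ + d z₃ z₄` with `a, b, c, d ∈ ℂ[z₁, z₂]`. -/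
@[ext]
structure SuperPoly where
  a : MvPolynomial (Fin 2) ℂ
  b : MvPolynomial (Fin 2) ℂ
  c : MvPolynomial (Fin 2) ℂ
  d : MvPolynomial (Fin 2) ℂ

namespace SuperPoly

instance : Zero SuperPoly := ⟨⟨0, 0, 0, 0⟩⟩
instance : One SuperPoly := ⟨⟨1, 0, 0, 0⟩⟩
instance : Add SuperPoly := ⟨fun p q => ⟨p.a + q.a, p.b + q.b, p.c + q.c, p.d + q.d⟩⟩
instance : Neg SuperPoly := ⟨fun p => ⟨-p.a, -p.b, -p.c, -p.d⟩⟩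
instance : SMul ℂ SuperPoly := ⟨fun t p => ⟨t • p.a, t • p.b, t • p.c, t • p.d⟩⟩

/-- The product is determined by `z₃² = z₄² = 0` and `z₄ z₃ = - z₃ z₄`. -/
instance : Mul SuperPoly :=
  ⟨fun p q => ⟨p.a * q.a, p.a * q.b + p.b * q.a, p.a * q.c + p.c * q.a,
    p.a * q.d + p.d * q.a + p.b * q.c - p.c * q.b⟩⟩

@[simp] theorem zero_a : (0 : SuperPoly).a = 0 := rfl
@[simp] theorem zero_b : (0 : SuperPoly).b = 0 := rfl
@[simp] theorem zero_c : (0 : SuperPoly).c = 0 := rfl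
@[simp] theorem zero_d : (0 : SuperPoly).d = 0 := rfl
@[simp] theorem one_a : (1 : SuperPoly).a = 1 := rfl
@[simp] theorem one_b : (1 : SuperPoly).b = 0 := rfl
@[simp] theorem one_c : (1 : SuperPoly).c = 0 := rfl
@[simp] theorem one_d : (1 : SuperPoly).d = 0 := rfl
@[simp] theorem add_a (p q : SuperPoly) : (p + q).a = p.a + q.a := rfl
@[simp] theorem add_b (p q : SuperPoly) : (p + q).b = p.b + q.b := rfl
@[simp] theorem add_c (p q : SuperPoly) : (p + q).c = p.c + q.c := rfl
@[simp] theorem add_d (p q : SuperPoly) : (p + q).d = p.d + q.d := rfl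
@[simp] theorem neg_a (p : SuperPoly) : (-p).a = -p.a := rfl
@[simp] theorem neg_b (p : SuperPoly) : (-p).b = -p.b := rfl
@[simp] theorem neg_c (p : SuperPoly) : (-p).c = -p.c := rfl
@[simp] theorem neg_d (p : SuperPoly) : (-p).d = -p.d := rfl
@[simp] theorem smul_a (t : ℂ) (p : SuperPoly) : (t • p).a = t • p.a := rfl
@[simp] theorem smul_b (t : ℂ) (p : SuperPoly) : (t • p).b = t • p.b := rfl
@[simp] theorem smul_c (t : ℂ) (p : SuperPoly) : (t • p).c = t • p.c := rfl
@[simp] theorem smul_d (t : ℂ) (p : SuperPoly) : (t • p).d = t • p.d := rfl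
@[simp] theorem mul_a (p q : SuperPoly) : (p * q).a = p.a * q.a := rfl
@[simp] theorem mul_b (p q : SuperPoly) : (p * q).b = p.a * q.b + p.b * q.a := rfl
@[simp] theorem mul_c (p q : SuperPoly) : (p * q).c = p.a * q.c + p.c * q.a := rfl
@[simp] theorem mul_d (p q : SuperPoly) :
    (p * q).d = p.a * q.d + p.d * q.a + p.b * q.c - p.c * q.b := rfl

instance : Ring SuperPoly where
  add_assoc := by intros; ext1 <;> simp <;> ring
  zero_add := by intros; ext1 <;> simp
  add_zero := by intros; ext1 <;> simp
  add_comm := by intros; ext1 <;> simp <;> ring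
  neg_add_cancel := by intros; ext1 <;> simp
  mul_assoc := by intros; ext1 <;> simp <;> ring
  one_mul := by intros; ext1 <;> simp
  mul_one := by intros; ext1 <;> simp
  zero_mul := by intros; ext1 <;> simp
  mul_zero := by intros; ext1 <;> simp
  left_distrib := by intros; ext1 <;> simp <;> ring
  right_distrib := by intros; ext1 <;> simp <;> ring
  nsmul := nsmulRec
  zsmul := zsmulRec

instance : Module ℂ SuperPoly where
  one_smul := by intros; ext1 <;> simp
  mul_smul := by intros; ext1 <;> simp [mul_smul]
  smul_zero := by intros; ext1 <;> simp
  smul_add := by intros; ext1 <;> simp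
  add_smul := by intros; ext1 <;> simp [add_smul]
  zero_smul := by intros; ext1 <;> simp

instance : Algebra ℂ SuperPoly :=
  Algebra.ofModule
    (by intros; ext1 <;> simp [smul_sub])
    (by intros; ext1 <;> simp [smul_sub])

/-- The coordinates `z₁, z₂` (even) and `z₃, z₄` (odd), numbered `0, 1, 2, 3`. -/
def z : Fin 4 → SuperPoly :=
  ![⟨MvPolynomial.X 0, 0, 0, 0⟩, ⟨MvPolynomial.X 1, 0, 0, 0⟩, ⟨0, 1, 0, 0⟩, ⟨0, 0, 1, 0⟩]

/-- The even partial derivative `∂/∂z_{i+1}`, `i = 0, 1`. -/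
def evenDeriv (i : Fin 2) : SuperPoly →ₗ[ℂ] SuperPoly where
  toFun p := ⟨MvPolynomial.pderiv i p.a, MvPolynomial.pderiv i p.b, MvPolynomial.pderiv i p.c,
    MvPolynomial.pderiv i p.d⟩
  map_add' p q := by ext1 <;> simp
  map_smul' t p := by ext1 <;> simp

/-- `∂/∂z₃`, an odd left derivation: `z₃ ↦ 1`, `z₃ z₄ ↦ z₄`. -/
def oddDeriv₃ : SuperPoly →ₗ[ℂ] SuperPoly where
  toFun p := ⟨p.b, 0, p.d, 0⟩
  map_add' p q := by ext1 <;> simp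
  map_smul' t p := by ext1 <;> simp

/-- `∂/∂z₄`, an odd left derivation: `z₄ ↦ 1`, `z₃ z₄ ↦ - z₃`. -/
def oddDeriv₄ : SuperPoly →ₗ[ℂ] SuperPoly where
  toFun p := ⟨p.c, -p.d, 0, 0⟩
  map_add' p q := by ext1 <;> simp [add_comm]
  map_smul' t p := by ext1 <;> simp

/-- The partial derivatives `∂/∂z₁, …, ∂/∂z₄`. -/
def partialD : Fin 4 → Module.End ℂ SuperPoly :=
  ![evenDeriv 0, evenDeriv 1, oddDeriv₃, oddDeriv₄]

/-- Left multiplication by the coordinate `z_{i+1}`. -/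
def mulZ (i : Fin 4) : Module.End ℂ SuperPoly := LinearMap.mulLeft ℂ (z i)

/-- The even part `{a + d z₃ z₄}`. -/
def evenPart : Submodule ℂ SuperPoly where
  carrier := {p | p.b = 0 ∧ p.c = 0}
  add_mem' := by rintro p q ⟨h1, h2⟩ ⟨h3, h4⟩; simp [h1, h2, h3, h4]
  zero_mem' := by simp
  smul_mem' := by rintro t p ⟨h1, h2⟩; simp [h1, h2]

/-- The odd part `{b z₃ + c z₄}`. -/
def oddPart : Submodule ℂ SuperPoly where
  carrier := {p | p.a = 0 ∧ p.d = 0}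
  add_mem' := by rintro p q ⟨h1, h2⟩ ⟨h3, h4⟩; simp [h1, h2, h3, h4]
  zero_mem' := by simp
  smul_mem' := by rintro t p ⟨h1, h2⟩; simp [h1, h2]

end SuperPoly

open SuperPoly

/-! ## The Jordan superalgebra `D_α` and its structure algebra -/

/-- The underlying space of `D_α` over `ℂ`; a vector lists the coordinates with respect to the
basis `e₁, e₂` (even), `ξ, η` (odd). -/
abbrev J := Fin 4 → ℂ

/-- Endomorphisms of `D_α`, as matrices with respect to `e₁, e₂, ξ, η`. -/
abbrev EndJ := Matrix (Fin 4) (Fin 4) ℂ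

/-- The parities of `e₁, e₂, ξ, η` (and of `z₁, z₂, z₃, z₄`). -/
def par : Fin 4 → ℕ := ![0, 0, 1, 1]

/-- The product of `D_α`: the bilinear map with `eᵢeᵢ = eᵢ`, `e₁e₂ = 0`,
`eᵢξ = ξeᵢ = ξ/2`, `eᵢη = ηeᵢ = η/2`, `ξη = -ηξ = e₁ + α e₂`, `ξ² = η² = 0`. -/
def jmul (α : ℂ) (x y : J) : J :=
  ![x 0 * y 0 + (x 2 * y 3 - x 3 * y 2),
    x 1 * y 1 + α * (x 2 * y 3 - x 3 * y 2),
    ((x 0 + x 1) * y 2 + x 2 * (y 0 + y 1)) / 2,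
    ((x 0 + x 1) * y 3 + x 3 * (y 0 + y 1)) / 2]

/-- The unit `e₁ + e₂` of `D_α`. -/
def unitJ : J := ![1, 1, 0, 0]

/-- The left multiplication operators `L_x`. -/
def L (α : ℂ) : J →ₗ[ℂ] EndJ where
  toFun x := Matrix.of fun i j => jmul α x (Pi.single j 1) i
  map_add' x y := by
    ext i j; fin_cases i <;> simp [jmul] <;> ring
  map_smul' t x := by
    ext i j; fin_cases i <;> simp [jmul] <;> ring

/-- The supercommutator on `End(D_α)`: the bilinear map with
`[A, B] = AB - (-1)^{|A||B|} BA` for homogeneous `A`, `B`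
(the matrix unit in position `(i, j)` has parity `|i| + |j|`). -/
def superComm (A B : EndJ) : EndJ :=
  Matrix.of fun i k => ∑ j, (A i j * B j k -
    (-1) ^ ((par i + par j) * (par j + par k)) * (B i j * A j k))

/-- The bilinear map with `(T, u) ↦ (-1)^{|T||u|} T u` for homogeneous `T`, `u`. -/
def signedApply (T : EndJ) (u : J) : J :=
  fun i => ∑ j, (-1) ^ ((par i + par j) * par j) * (T i j * u j)

/-- The derivations `Der(D_α)`: those `D` with `[D, L_x] = L_{D(x)}` for all `x`. -/
def der (α : ℂ) : Submodule ℂ EndJ where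
  carrier := {D | ∀ x : J, superComm D (L α x) = L α (D *ᵥ x)}
  add_mem' := by
    intro D E hD hE x
    have h : superComm (D + E) (L α x) = superComm D (L α x) + superComm E (L α x) := by
      ext i k
      simp only [superComm, Matrix.of_apply, Matrix.add_apply, ← Finset.sum_add_distrib]
      exact Finset.sum_congr rfl fun j _ => by ring
    rw [h, hD x, hE x, Matrix.add_mulVec, map_add]
  zero_mem' := by
    intro x
    ext i k
    simp [superComm]
  smul_mem' := by
    intro t D hD x
    have h : superComm (t • D) (L α x) = t • superComm D (L α x) := by
      ext i k
      simp only [superComm, Matrix.of_apply, Matrix.smul_apply, smul_eq_mul, Finset.mul_sum]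
      exact Finset.sum_congr rfl fun j _ => by ring
    rw [h, hD x, Matrix.smul_mulVec, map_smul]

/-- The structure algebra `str(D_α) = ⟨L_x⟩ ⊕ Der(D_α)`. -/
def str (α : ℂ) : Submodule ℂ EndJ := LinearMap.range (L α) ⊔ der α

/-! ## The Lie superalgebra `D(2,1;α) = TKK(D_α)` -/

/-- The ambient space of triples `(u, T, x)` with `u ∈ D_α⁻`, `T ∈ End(D_α)`, `x ∈ D_α⁺`. -/
abbrev Triple := J × EndJ × J

/-- The action of `str(D_α)` on `D_α⁻`, which is `L_a + I ↦ -L_a + I` for `I ∈ Der(D_α)`: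
a derivation kills the unit `1`, so that `a = T(1)` for `T = L_a + I`. -/
def minusAct (α : ℂ) (T : EndJ) : EndJ := T - (2 : ℂ) • L α (T *ᵥ unitJ)

/-- The bracket of the Tits–Kantor–Koecher construction, the super-skewsymmetric bilinear map with
`[L_a, x] = ax`, `[I, x] = I x`, `[L_a, u] = -au`, `[I, u] = I u`, `[x, y] = 0 = [u, v]`,
`[x, u] = 2 L_{xu} + 2 [L_x, L_u]` (so `[u, x] = -2 L_{ux} + 2 [L_u, L_x]`), and the
supercommutator on `str(D_α)`. -/
def bracket (α : ℂ) (X Y : Triple) : Triple :=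
  (minusAct α X.2.1 *ᵥ Y.1 - signedApply (minusAct α Y.2.1) X.1,
   superComm X.2.1 Y.2.1
     + (2 : ℂ) • (L α (jmul α X.2.2 Y.1) + superComm (L α X.2.2) (L α Y.1))
     + (2 : ℂ) • (-L α (jmul α X.1 Y.2.2) + superComm (L α X.1) (L α Y.2.2)),
   X.2.1 *ᵥ Y.2.2 - signedApply Y.2.1 X.2.2)

theorem superComm_add_right (A B C : EndJ) :
    superComm A (B + C) = superComm A B + superComm A C := by
  ext i k
  simp only [superComm, Matrix.of_apply, Matrix.add_apply, ← Finset.sum_add_distrib]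
  exact Finset.sum_congr rfl fun j _ => by ring

theorem superComm_smul_right (t : ℂ) (A B : EndJ) :
    superComm A (t • B) = t • superComm A B := by
  ext i k
  simp only [superComm, Matrix.of_apply, Matrix.smul_apply, smul_eq_mul, Finset.mul_sum]
  exact Finset.sum_congr rfl fun j _ => by ring

theorem signedApply_add_left (S T : EndJ) (u : J) :
    signedApply (S + T) u = signedApply S u + signedApply T u := by
  ext i
  simp only [signedApply, Pi.add_apply, Matrix.add_apply, ← Finset.sum_add_distrib]
  exact Finset.sum_congr rfl fun j _ => by ring

theorem signedApply_smul_left (t : ℂ) (T : EndJ) (u : J) :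
    signedApply (t • T) u = t • signedApply T u := by
  ext i
  simp only [signedApply, Pi.smul_apply, Matrix.smul_apply, smul_eq_mul, Finset.mul_sum]
  exact Finset.sum_congr rfl fun j _ => by ring

theorem jmul_add_right (α : ℂ) (x y w : J) : jmul α x (y + w) = jmul α x y + jmul α x w := by
  ext i; fin_cases i <;> simp [jmul] <;> ring

theorem jmul_smul_right (α t : ℂ) (x y : J) : jmul α x (t • y) = t • jmul α x y := by
  ext i; fin_cases i <;> simp [jmul] <;> ring

theorem minusAct_add (α : ℂ) (S T : EndJ) :
    minusAct α (S + T) = minusAct α S + minusAct α T := by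
  simp only [minusAct, Matrix.add_mulVec, map_add, smul_add]; abel

theorem minusAct_smul (α t : ℂ) (T : EndJ) : minusAct α (t • T) = t • minusAct α T := by
  simp only [minusAct, Matrix.smul_mulVec, map_smul, smul_sub, smul_comm t (2 : ℂ)]

/-- `ad(X) = [X, ·]`. -/
def ad (α : ℂ) (X : Triple) : Module.End ℂ Triple where
  toFun Y := bracket α X Y
  map_add' Y W := by
    simp only [bracket, Prod.fst_add, Prod.snd_add, Prod.mk_add_mk, Matrix.mulVec_add,
      minusAct_add, signedApply_add_left, superComm_add_right, jmul_add_right, map_add]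
    refine Prod.ext ?_ (Prod.ext ?_ ?_)
    · dsimp only; abel
    · dsimp only; module
    · dsimp only; abel
  map_smul' t Y := by
    simp only [bracket, Prod.smul_fst, Prod.smul_snd, Prod.smul_mk, Matrix.mulVec_smul,
      minusAct_smul, signedApply_smul_left, superComm_smul_right, jmul_smul_right, map_smul,
      RingHom.id_apply]
    refine Prod.ext ?_ (Prod.ext ?_ ?_)
    · dsimp only; module
    · dsimp only; module
    · dsimp only; module

/-- The triples all of whose coordinates lie in a subfield `K` of `ℂ`. -/
def coordsIn (K : Subfield ℂ) : Submodule K Triple where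
  carrier := {X | (∀ i, X.1 i ∈ K) ∧ (∀ i j, X.2.1 i j ∈ K) ∧ ∀ i, X.2.2 i ∈ K}
  add_mem' := by
    rintro X Y ⟨h1, h2, h3⟩ ⟨k1, k2, k3⟩
    exact ⟨fun i => K.add_mem (h1 i) (k1 i), fun i j => K.add_mem (h2 i j) (k2 i j),
      fun i => K.add_mem (h3 i) (k3 i)⟩
  zero_mem' := ⟨fun _ => K.zero_mem, fun _ _ => K.zero_mem, fun _ => K.zero_mem⟩
  smul_mem' := by
    rintro t X ⟨h1, h2, h3⟩
    exact ⟨fun i => K.mul_mem t.2 (h1 i), fun i j => K.mul_mem t.2 (h2 i j),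
      fun i => K.mul_mem t.2 (h3 i)⟩

/-- `𝔤_ℂ = D_α⁻ ⊕ str(D_α) ⊕ D_α⁺` over `ℂ`. -/
def gC (α : ℂ) : Submodule ℂ Triple :=
  (str α).comap (LinearMap.fst ℂ EndJ J ∘ₗ LinearMap.snd ℂ J (EndJ × J))

/-- `𝔤 = TKK(D_α) = D(2,1;α)` over the subfield `K` of `ℂ` (for `α ∈ K`). -/
def g (K : Subfield ℂ) (α : ℂ) : Submodule K Triple :=
  (gC α).restrictScalars K ⊓ coordsIn K

/-- `𝔨 = {(a, I, -a) | I ∈ Der(D_α), a ∈ D_α}` over `K`. -/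
def k (K : Subfield ℂ) (α : ℂ) : Set Triple :=
  {X | X ∈ g K α ∧ X.2.1 ∈ der α ∧ X.2.2 = -X.1}

/-- `𝔨₀ = 𝔨 ∩ str(D_α) = Der(D_α)` over `K`. -/
def k₀ (K : Subfield ℂ) (α : ℂ) : Set Triple :=
  {X | X ∈ k K α ∧ X.1 = 0}

/-- `X` is homogeneous of parity `p ∈ {0, 1}`. -/
def HasParity (p : ℕ) (X : Triple) : Prop :=
  (∀ i, par i ≠ p → X.1 i = 0) ∧ (∀ i j, (par i + par j) % 2 ≠ p → X.2.1 i j = 0) ∧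
    ∀ i, par i ≠ p → X.2.2 i = 0

/-- The unit `e` of `D_α⁺`, as an element of `𝔤`. -/
def eElt : Triple := (0, 0, unitJ)

/-- The unit `f` of `D_α⁻`, as an element of `𝔤`. -/
def fElt : Triple := (unitJ, 0, 0)

/-- The Cayley transform `c = exp((i/2) ad f) exp(i ad e)`; both exponents are nilpotent. -/
def cayley (α : ℂ) : Module.End ℂ Triple :=
  IsNilpotent.exp ((Complex.I / 2) • ad α fElt) * IsNilpotent.exp (Complex.I • ad α eElt)

/-! ## The representations `π_λ` and `ρ_λ` -/

/-- The Bessel operators `𝓑_λ(z₁), …, 𝓑_λ(z₄)` (that is, at `e₁, e₂, ξ, η`). -/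
def bessel (α lam : ℂ) : Fin 4 → Module.End ℂ SuperPoly :=
  ![((-lam) • 1 + mulZ 0 * partialD 0 + mulZ 2 * partialD 2 + mulZ 3 * partialD 3) * partialD 0
      - (2 * α) • (mulZ 1 * partialD 2 * partialD 3),
    ((-(lam / α)) • 1 + mulZ 1 * partialD 1 + mulZ 2 * partialD 2 + mulZ 3 * partialD 3)
        * partialD 1
      - (2 : ℂ) • (mulZ 0 * partialD 2 * partialD 3),
    ((-2 * lam) • 1 + (2 : ℂ) • (mulZ 0 * partialD 0) + (2 * α) • (mulZ 1 * partialD 1)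
        + (2 * (1 + α)) • (mulZ 2 * partialD 2)) * partialD 3
      + mulZ 2 * partialD 0 * partialD 1,
    ((2 * lam) • 1 - (2 : ℂ) • (mulZ 0 * partialD 0) - (2 * α) • (mulZ 1 * partialD 1)
        - (2 * (1 + α)) • (mulZ 3 * partialD 3)) * partialD 2
      + mulZ 3 * partialD 0 * partialD 1]

/-- The character of `str(D_α)` with `2 L_{e₁} ↦ λ`, `2 L_{e₂} ↦ λ/α`,
`L_ξ, L_η ↦ 0`, `Der(D_α) ↦ 0`. -/
def character (α lam : ℂ) (T : EndJ) : ℂ :=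
  (lam * (T *ᵥ unitJ) 0 + lam / α * (T *ᵥ unitJ) 1) / 2

/-- The representation `π_λ` on `𝒫(ℂ^{2|2})`: `u ∈ D_α⁻` acts as multiplication by `-2i u`,
`T ∈ str(D_α)` as `λ(T) + ∑ⱼ [T, fⱼ] ∂ⱼ` for the standard basis `fⱼ ↔ zⱼ` of `D_α⁻`,
and `x ∈ D_α⁺` as `-(i/2) 𝓑_λ(x)`. -/
def piRep (α lam : ℂ) (X : Triple) : Module.End ℂ SuperPoly :=
  (-2 * Complex.I) • ∑ i, X.1 i • mulZ i
    + (character α lam X.2.1 • 1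
      + ∑ j, ∑ i, minusAct α X.2.1 i j • (mulZ i * partialD j))
    + (-(Complex.I / 2)) • ∑ i, X.2.2 i • bessel α lam i

/-- The Fock representation `ρ_λ = π_λ ∘ c` on `𝒫(ℂ^{2|2})`. -/
def rho (α lam : ℂ) (X : Triple) : Module.End ℂ SuperPoly := piRep α lam (cayley α X)

/-! ## The polynomial Fock space -/

/-- The two cases `λ = α` and `λ = 1`. -/
inductive LamCase
  | alpha
  | one

namespace LamCase

/-- The value of `λ`. -/
def lam (α : ℂ) : LamCase → ℂ
  | alpha => α
  | one => 1

/-- `α` if `λ = α`, and `α⁻¹` if `λ = 1`. -/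
def mu (α : ℂ) : LamCase → ℂ
  | alpha => α
  | one => α⁻¹

/-- `z₁` if `λ = α`, and `z₂` if `λ = 1`. -/
def zi : LamCase → SuperPoly
  | alpha => z 0
  | one => z 1

/-- `z₂` if `λ = α`, and `z₁` if `λ = 1`. -/
def zj : LamCase → SuperPoly
  | alpha => z 1
  | one => z 0

end LamCase

/-- `V_α` is spanned by `2 z₁ z₂ + z₃ z₄, z₂², z₂ z₃, z₂ z₄`, and
`V_1` by `2 α z₁ z₂ + z₃ z₄, z₁², z₁ z₃, z₁ z₄`. -/
def V (α : ℂ) : LamCase → Submodule ℂ SuperPoly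
  | .alpha => Submodule.span ℂ
      {(2 : ℂ) • (z 0 * z 1) + z 2 * z 3, z 1 ^ 2, z 1 * z 2, z 1 * z 3}
  | .one => Submodule.span ℂ
      {(2 * α) • (z 0 * z 1) + z 2 * z 3, z 0 ^ 2, z 0 * z 2, z 0 * z 3}

/-- The ideal `I_λ = 𝒫(ℂ^{2|2}) V_λ`. -/
def idealI (α : ℂ) (s : LamCase) : Submodule ℂ SuperPoly :=
  (Ideal.span (V α s : Set SuperPoly)).restrictScalars ℂ

/-- The polynomial Fock space `𝒫(ℂ^{2|2}) / I_λ`. -/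
abbrev Fock (α : ℂ) (s : LamCase) := SuperPoly ⧸ idealI α s

/-- The class of a superpolynomial in the Fock space. -/
def cls (α : ℂ) (s : LamCase) : SuperPoly →ₗ[ℂ] Fock α s := (idealI α s).mkQ

/-- `N ⊆ 𝒫(ℂ^{2|2}) / I_λ` is a graded subspace: it is spanned by its even and odd elements. -/
def IsGraded {α : ℂ} {s : LamCase} (N : Submodule ℂ (Fock α s)) : Prop :=
  N = (N ⊓ evenPart.map (cls α s)) ⊔ (N ⊓ oddPart.map (cls α s))

/-- `N ⊆ 𝒫(ℂ^{2|2}) / I_λ` is stable under the operators `[p] ↦ [ρ_λ(X) p]`, `X ∈ S`. -/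
def IsInvariant {α : ℂ} {s : LamCase} (S : Set Triple) (N : Submodule ℂ (Fock α s)) : Prop :=
  ∀ X ∈ S, ∀ p : SuperPoly, cls α s p ∈ N → cls α s (rho α (s.lam α) X p) ∈ N

/-- `N` is a sub-supermodule for `S`. -/
def IsSubmod {α : ℂ} {s : LamCase} (S : Set Triple) (N : Submodule ℂ (Fock α s)) : Prop :=
  IsGraded N ∧ IsInvariant S N

/-- `M` is an irreducible supermodule for `S`. We ask for more than the absence of graded
submodules: no invariant subspace, graded or not, lies strictly between `0` and `M`. -/
def IsIrred {α : ℂ} {s : LamCase} (S : Set Triple) (M : Submodule ℂ (Fock α s)) : Prop :=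
  IsSubmod S M ∧ M ≠ ⊥ ∧ ∀ N ≤ M, IsInvariant S N → N = ⊥ ∨ N = M

/-- `M` is an indecomposable supermodule for `S`: it is not the direct sum of two nonzero invariant
subspaces, graded or not. -/
def IsIndecomp {α : ℂ} {s : LamCase} (S : Set Triple) (M : Submodule ℂ (Fock α s)) : Prop :=
  IsSubmod S M ∧ M ≠ ⊥ ∧ ∀ N₁ N₂ : Submodule ℂ (Fock α s),
    IsInvariant S N₁ → IsInvariant S N₂ → N₁ ⊓ N₂ = ⊥ → N₁ ⊔ N₂ = M → N₁ = ⊥ ∨ N₂ = ⊥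

/-- `F_λ = U(𝔤) 1 mod I_λ`, with `U(𝔤)` acting through `ρ_λ`. -/
def F (K : Subfield ℂ) (α : ℂ) (s : LamCase) : Submodule ℂ (Fock α s) :=
  ((Subalgebra.toSubmodule
      (Algebra.adjoin ℂ {A | ∃ X ∈ g K α, A = rho α (s.lam α) X})).map
    (LinearMap.applyₗ (1 : SuperPoly))).map (cls α s)

/-- `F_{λ,0} = ℂ` and `F_{λ,n} = (ℂ z₁ ⊕ ℂ z₂ ⊕ ℂ z₃ ⊕ ℂ z₄) zᵢ^{n-1}` for `n ≥ 1`, with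
`i = 1` if `λ = α` and `i = 2` if `λ = 1`. -/
def Fk (α : ℂ) (s : LamCase) : ℕ → Submodule ℂ (Fock α s)
  | 0 => Submodule.span ℂ {cls α s 1}
  | n + 1 => Submodule.span ℂ (Set.range fun j : Fin 4 => cls α s (z j * s.zi ^ n))

/-- For `n ≥ 1`, `H_{α,n} = (ℂ (z₁ + (n-1-α) z₂) ⊕ ℂ z₃ ⊕ ℂ z₄) z₁^{n-1}` and
`H_{1,n} = (ℂ (z₂ + (n-1-α⁻¹) z₁) ⊕ ℂ z₃ ⊕ ℂ z₄) z₂^{n-1}`; not meant for `n = 0`. -/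
def Hk (α : ℂ) (s : LamCase) (n : ℕ) : Submodule ℂ (Fock α s) :=
  Submodule.span ℂ {cls α s ((s.zi + ((n : ℂ) - 1 - s.mu α) • s.zj) * s.zi ^ (n - 1)),
    cls α s (z 2 * s.zi ^ (n - 1)), cls α s (z 3 * s.zi ^ (n - 1))}

/-- The line `ℂ (z₁ + z₂)^n`. -/
def line (α : ℂ) (s : LamCase) (n : ℕ) : Submodule ℂ (Fock α s) :=
  Submodule.span ℂ {cls α s ((z 0 + z 1) ^ n)}

end FockD

end

open FockD

noncomputable section

namespace FockD

open scoped Matrix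
open SuperPoly

/-! ## Coordinates on the Lie superalgebra -/

/-! The quotient by `I_λ` is small enough to compute in. Its relations kill `z_j²`, `z_j z₃`, `z_j
z₄` and turn `z₃ z₄` into `-2κ z₁ z₂`, so each class has a unique representative `A(z_i) + z_j
B(z_i) + z₃ C(z_i) + z₄ D(z_i)`. The map `red` reads off these four one-variable polynomials; it is
onto with kernel `I_λ` (`ker_red`, `red_surjective`). The operators of `π_λ` descend to explicit
operators `sU`, `sT`, `sX` on quadruples (`red_mU`, `red_mT`, `red_mX`), which makes `I_λ` a
submodule.

That `ρ_λ` is a representation has two ingredients: the Cayley transform respects brackets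
(`cayley_bracket_elt`), and `π_λ` is a representation (`piRep_bracket`), checked block by block for
multiplications, first-order operators and Bessel operators.

The Cayley transform carries `𝔨` into `str(D_α)`, so `𝔨` acts through degree-preserving operators,
given on `F_{λ,n+1} ≅ ℂ⁴` by the matrices `act`. The even derivations contain an `sl₂` for which
`z₃, z₄` span the standard module, so a vector with nonzero odd part generates all odd vectors
(`IsInvariant.odd_mem`). An odd derivation sends odd vectors to multiples of the even vector `(1, n
- μ)` of `H_{λ,n+1}`, and kills exactly the even vectors proportional to `(1, n + 1)`, the
coordinates of `(z₁ + z₂)^{n+1}`. These two lines coincide iff `μ = -1`, that is, iff `α = -1`. This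
gives the splitting for `α ≠ -1` and the indecomposability for `α = -1`. Over `𝔨` the operator
coming from `L_ξ` produces in addition `(1, -(n - μ))`, independent of `(1, n - μ)` because `μ ∉ ℕ`,
so `F_{λ,n+1}` is irreducible.

Over `𝔤` the multiplications and the Bessel operators act separately (`IsInvariant.sU_sX_mem`). The
Bessel operators lower the degree and have only constants as common kernel
(`exists_eq_of_sX_eq_zero`), so every nonzero invariant subspace contains `1`; multiplications then
generate everything. The components are independent because they lie in distinct eigenspaces of an
Euler operator. -/

/-- The derivation of `D_α` with parameters `d`: it acts on `ξ, η` through the `sl₂`-matrix with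
entries `d 0, d 1, d 2`, and sends `e₁` to `d 3 • ξ + d 4 • η`. -/
def dmat (α : ℂ) (d : Fin 5 → ℂ) : EndJ :=
  !![0, 0, 2 * d 4, -2 * d 3;
     0, 0, -2 * α * d 4, 2 * α * d 3;
     d 3, -d 3, d 0, d 1;
     d 4, -d 4, d 2, -d 0]

/-- The parameters of the inner derivation `[L_a, L_b]`. -/
def inn (α : ℂ) (a b : J) : Fin 5 → ℂ :=
  ![-(1 + α) / 2 * (a 2 * b 3 + a 3 * b 2), (1 + α) * (a 2 * b 2), -(1 + α) * (a 3 * b 3),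
    (a 2 * (b 0 - b 1) - (a 0 - a 1) * b 2) / 4, (a 3 * (b 0 - b 1) - (a 0 - a 1) * b 3) / 4]

/-- The parameters of the supercommutator of two derivations. -/
def dbr (α : ℂ) (d d' : Fin 5 → ℂ) : Fin 5 → ℂ :=
  ![d 1 * d' 2 - d' 1 * d 2 + 2 * (1 + α) * (d 3 * d' 4 + d' 3 * d 4),
    2 * (d 0 * d' 1 - d 1 * d' 0) - 4 * (1 + α) * (d 3 * d' 3),
    2 * (d 2 * d' 0 - d 0 * d' 2) + 4 * (1 + α) * (d 4 * d' 4),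
    d 0 * d' 3 + d 1 * d' 4 - (d' 0 * d 3 + d' 1 * d 4),
    d 2 * d' 3 - d 0 * d' 4 - (d' 2 * d 3 - d' 0 * d 4)]

/-- The element `u + (L_a + D) + x` of `𝔤`, where `D` is the derivation with parameters `d`. -/
def elt (α : ℂ) (u a : J) (d : Fin 5 → ℂ) (x : J) : Triple := (u, L α a + dmat α d, x)

theorem L_eq (α : ℂ) (a : J) : L α a =
    !![a 0, 0, -a 3, a 2;
       0, a 1, -(α * a 3), α * a 2;
       a 2 / 2, a 2 / 2, (a 0 + a 1) / 2, 0;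
       a 3 / 2, a 3 / 2, 0, (a 0 + a 1) / 2] := by
  ext i j
  fin_cases i <;> fin_cases j <;> simp [L, jmul]

theorem L_mulVec (α : ℂ) (a x : J) : L α a *ᵥ x = jmul α a x := by
  rw [L_eq]
  ext i
  fin_cases i <;> simp [jmul, Matrix.mulVec, dotProduct, Fin.sum_univ_four] <;> ring

theorem dmat_mulVec (α : ℂ) (d : Fin 5 → ℂ) (x : J) : dmat α d *ᵥ x =
    ![2 * (d 4 * x 2 - d 3 * x 3), -(2 * α * (d 4 * x 2 - d 3 * x 3)),
      d 3 * (x 0 - x 1) + d 0 * x 2 + d 1 * x 3, d 4 * (x 0 - x 1) + d 2 * x 2 - d 0 * x 3] := by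
  ext i
  fin_cases i <;> simp [dmat, Matrix.mulVec, dotProduct, Fin.sum_univ_four] <;> ring

theorem jmul_unitJ (α : ℂ) (a : J) : jmul α a unitJ = a := by
  ext i; fin_cases i <;> simp [jmul, unitJ] <;> ring

theorem elt_mulVec_unitJ (α : ℂ) (a : J) (d : Fin 5 → ℂ) :
    (L α a + dmat α d) *ᵥ unitJ = a := by
  rw [Matrix.add_mulVec, L_mulVec, jmul_unitJ, dmat_mulVec]
  ext i; fin_cases i <;> simp [unitJ]

theorem minusAct_elt (α : ℂ) (a : J) (d : Fin 5 → ℂ) :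
    minusAct α (L α a + dmat α d) = L α (-a) + dmat α d := by
  rw [minusAct, elt_mulVec_unitJ, map_neg]; module

theorem superComm_L_L (α : ℂ) (a b : J) : superComm (L α a) (L α b) = dmat α (inn α a b) := by
  rw [L_eq, L_eq]
  ext i j
  fin_cases i <;> fin_cases j <;>
    simp [superComm, dmat, inn, Fin.sum_univ_four, par] <;> ring

theorem superComm_dmat_dmat (α : ℂ) (d d' : Fin 5 → ℂ) :
    superComm (dmat α d) (dmat α d') = dmat α (dbr α d d') := by
  ext i j
  fin_cases i <;> fin_cases j <;>
    simp [superComm, dmat, dbr, Fin.sum_univ_four, par] <;> ring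

theorem superComm_dmat_L (α : ℂ) (d : Fin 5 → ℂ) (a : J) :
    superComm (dmat α d) (L α a) = L α (dmat α d *ᵥ a) := by
  rw [dmat_mulVec, L_eq, L_eq]
  ext i j
  fin_cases i <;> fin_cases j <;>
    simp [superComm, dmat, Fin.sum_univ_four, par] <;> ring

/-- The vector `∑ (-1)^{|D||a|} D a` for the derivation `D` with parameters `d`. -/
def sder (α : ℂ) (d : Fin 5 → ℂ) (x : J) : J :=
  ![-2 * (d 4 * x 2 - d 3 * x 3), 2 * α * (d 4 * x 2 - d 3 * x 3),
      d 3 * (x 0 - x 1) + d 0 * x 2 + d 1 * x 3, d 4 * (x 0 - x 1) + d 2 * x 2 - d 0 * x 3]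

theorem signedApply_dmat (α : ℂ) (d : Fin 5 → ℂ) (x : J) :
    signedApply (dmat α d) x = sder α d x := by
  ext i
  fin_cases i <;> simp [signedApply, sder, dmat, Fin.sum_univ_four, par] <;> ring

theorem signedApply_L (α : ℂ) (a x : J) : signedApply (L α a) x = jmul α x a := by
  rw [L_eq]
  ext i
  fin_cases i <;> simp [signedApply, jmul, Fin.sum_univ_four, par] <;> ring

theorem superComm_L_dmat (α : ℂ) (d : Fin 5 → ℂ) (a : J) :
    superComm (L α a) (dmat α d) = L α (-sder α d a) := by
  rw [L_eq, L_eq]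
  ext i j
  fin_cases i <;> fin_cases j <;>
    simp [superComm, dmat, sder, Fin.sum_univ_four, par] <;> ring

theorem superComm_add_left (A B C : EndJ) :
    superComm (A + B) C = superComm A C + superComm B C := by
  ext i k
  simp only [superComm, Matrix.of_apply, Matrix.add_apply, ← Finset.sum_add_distrib]
  exact Finset.sum_congr rfl fun j _ => by ring

theorem dmat_add (α : ℂ) (d d' : Fin 5 → ℂ) : dmat α (d + d') = dmat α d + dmat α d' := by
  ext i j
  fin_cases i <;> fin_cases j <;> simp [dmat] <;> ring

theorem dmat_smul (α t : ℂ) (d : Fin 5 → ℂ) : dmat α (t • d) = t • dmat α d := by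
  ext i j
  fin_cases i <;> fin_cases j <;> simp [dmat] <;> ring

theorem dmat_zero (α : ℂ) : dmat α 0 = 0 := by
  simpa using dmat_smul α 0 0

/-- Turns the bracket into polynomial formulas in the coordinates `u, a, d, x`, so that later
identities in `𝔤_ℂ` become scalar ones. -/
theorem bracket_elt (α : ℂ) (u a x u' a' x' : J) (d d' : Fin 5 → ℂ) :
    bracket α (elt α u a d x) (elt α u' a' d' x') =
      elt α (-jmul α a u' + dmat α d *ᵥ u' + jmul α u a' - sder α d' u)
        (dmat α d *ᵥ a' - sder α d' a + (2 : ℂ) • jmul α x u' - (2 : ℂ) • jmul α u x')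
        (inn α a a' + dbr α d d' + (2 : ℂ) • inn α x u' + (2 : ℂ) • inn α u x')
        (jmul α a x' + dmat α d *ᵥ x' - jmul α x a' - sder α d' x) := by
  have hL : ∀ y z : J, signedApply (L α (-y)) z = -jmul α z y := by
    intro y z
    rw [signedApply_L]
    simpa using jmul_smul_right α (-1) z y
  refine Prod.ext ?_ (Prod.ext ?_ ?_)
  · simp only [bracket, elt, minusAct_elt, Matrix.add_mulVec, signedApply_add_left, hL,
      signedApply_dmat]
    rw [map_neg, Matrix.neg_mulVec, L_mulVec]; abel
  · simp only [bracket, elt, superComm_add_left, superComm_add_right, superComm_L_L,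
      superComm_dmat_dmat, superComm_dmat_L, superComm_L_dmat, map_add, map_sub, map_neg,
      map_smul, dmat_add, dmat_smul]
    module
  · simp only [bracket, elt, Matrix.add_mulVec, signedApply_add_left, L_mulVec, signedApply_L,
      signedApply_dmat]
    abel

theorem dmat_mem_der (α : ℂ) (d : Fin 5 → ℂ) : dmat α d ∈ der α :=
  fun x => superComm_dmat_L α d x

theorem elt_mem_gC (α : ℂ) (u a : J) (d : Fin 5 → ℂ) (x : J) : elt α u a d x ∈ gC α :=
  Submodule.add_mem_sup ⟨a, rfl⟩ (dmat_mem_der α d)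

/-- The derivation identity on the four basis vectors is a linear system in the sixteen matrix
entries, with five entries left free. -/
theorem exists_dmat_of_mem_der {α : ℂ} {D : EndJ} (hD : D ∈ der α) :
    ∃ d, D = dmat α d := by
  have h : ∀ (x : J) (i j : Fin 4), superComm D (L α x) i j = L α (D *ᵥ x) i j :=
    fun x i j => by rw [hD x]
  simp only [L_eq] at h
  refine ⟨![D 2 2, D 2 3, D 3 2, D 2 0, D 3 0], ?_⟩
  have e0 := h ![1, 0, 0, 0]
  have e1 := h ![0, 1, 0, 0]
  have e2 := h ![0, 0, 1, 0]
  have e3 := h ![0, 0, 0, 1]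
  simp only [Fin.forall_fin_succ, superComm, Matrix.mulVec, dotProduct, Fin.sum_univ_four,
    par] at e0 e1 e2 e3
  simp at e0 e1 e2 e3
  ext i j
  fin_cases i <;> fin_cases j <;> simp [dmat] <;> grind

theorem exists_elt_of_mem_gC {α : ℂ} {X : Triple} (hX : X ∈ gC α) :
    ∃ u a d x, X = elt α u a d x := by
  obtain ⟨u, T, x⟩ := X
  obtain ⟨A, ⟨a, rfl⟩, D, hD, h⟩ := Submodule.mem_sup.1 (show T ∈ str α from hX)
  obtain ⟨d, rfl⟩ := exists_dmat_of_mem_der hD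
  exact ⟨u, a, d, x, by rw [elt, h]⟩

/-! ## The Cayley transform -/

theorem unitJ_jmul (α : ℂ) (a : J) : jmul α unitJ a = a := by
  ext i; fin_cases i <;> simp [jmul, unitJ] <;> ring

theorem inn_unitJ (α : ℂ) (a : J) : inn α unitJ a = 0 := by
  ext i; fin_cases i <;> simp [inn, unitJ]

theorem signedApply_unitJ (T : EndJ) : signedApply T unitJ = T *ᵥ unitJ := by
  ext i
  fin_cases i <;> simp [signedApply, unitJ, Fin.sum_univ_four, par, Matrix.mulVec, dotProduct]

theorem minusAct_mulVec_unitJ (α : ℂ) (T : EndJ) : minusAct α T *ᵥ unitJ = -(T *ᵥ unitJ) := by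
  rw [minusAct, Matrix.sub_mulVec, Matrix.smul_mulVec, L_mulVec, jmul_unitJ]; module

theorem minusAct_zero (α : ℂ) : minusAct α 0 = 0 := by
  simp [minusAct]

theorem zero_jmul (α : ℂ) (x : J) : jmul α 0 x = 0 := by
  ext i; fin_cases i <;> simp [jmul]

theorem zero_superComm (A : EndJ) : superComm 0 A = 0 := by
  ext i; simp [superComm]

theorem signedApply_zero (A : EndJ) : signedApply A 0 = 0 := by
  ext i; simp [signedApply]

theorem ad_fElt_apply (α : ℂ) (u x : J) (T : EndJ) :
    ad α fElt (u, T, x) = (T *ᵥ unitJ, -(2 : ℂ) • L α x, 0) := by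
  refine Prod.ext ?_ (Prod.ext ?_ ?_)
  · simp [ad, bracket, fElt, signedApply_unitJ, minusAct_mulVec_unitJ, minusAct_zero]
  · simp [ad, bracket, fElt, superComm_L_L, unitJ_jmul, inn_unitJ, zero_jmul, zero_superComm,
      dmat_zero]
  · simp [ad, bracket, fElt, signedApply_zero]

theorem ad_eElt_apply (α : ℂ) (u x : J) (T : EndJ) :
    ad α eElt (u, T, x) = (0, (2 : ℂ) • L α u, -(T *ᵥ unitJ)) := by
  refine Prod.ext ?_ (Prod.ext ?_ ?_)
  · simp [ad, bracket, eElt, signedApply_zero, minusAct_zero]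
  · simp [ad, bracket, eElt, superComm_L_L, unitJ_jmul, inn_unitJ, zero_jmul, zero_superComm,
      dmat_zero]
  · simp [ad, bracket, eElt, signedApply_unitJ]

/-- Since `ad f` shifts the three-step grading `D⁺ → str → D⁻`, its cube vanishes and the
exponential has three terms. -/
theorem exp_ad_fElt_apply (α : ℂ) (u x : J) (T : EndJ) :
    IsNilpotent.exp ((Complex.I / 2) • ad α fElt) (u, T, x) =
      (u + (Complex.I / 2) • (T *ᵥ unitJ) + (1 / 4 : ℂ) • x, T - Complex.I • L α x, x) := by
  have hf : ((Complex.I / 2) • ad α fElt) ^ 3 = 0 := by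
    refine LinearMap.ext fun ⟨u, T, x⟩ => ?_
    simp [pow_succ, ad_fElt_apply, L_mulVec, jmul_unitJ, Matrix.smul_mulVec, Matrix.neg_mulVec]
  have hI : Complex.I / 2 * (Complex.I / 2) = -1 / 4 := by linear_combination Complex.I_sq / 4
  rw [IsNilpotent.exp_eq_sum hf]
  simp only [Finset.sum_range_succ, Finset.sum_range_zero, Nat.factorial, pow_succ, pow_zero,
    one_mul, zero_add, Module.End.mul_apply, LinearMap.add_apply, LinearMap.smul_apply,
    Module.End.one_apply, map_smul, smul_smul, hI]
  simp only [ad_fElt_apply, Prod.smul_mk, Prod.mk_add_mk, L_mulVec, jmul_unitJ,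
    Matrix.smul_mulVec]
  refine Prod.ext ?_ (Prod.ext ?_ ?_)
  · simp [← Rat.cast_smul_eq_qsmul ℂ]; module
  · simp [← Rat.cast_smul_eq_qsmul ℂ]; module
  · simp

theorem exp_ad_eElt_apply (α : ℂ) (u x : J) (T : EndJ) :
    IsNilpotent.exp (Complex.I • ad α eElt) (u, T, x) =
      (u, T + (2 * Complex.I) • L α u, x - Complex.I • (T *ᵥ unitJ) + u) := by
  have he : (Complex.I • ad α eElt) ^ 3 = 0 := by
    refine LinearMap.ext fun ⟨u, T, x⟩ => ?_
    simp [pow_succ, ad_eElt_apply, L_mulVec, jmul_unitJ, Matrix.smul_mulVec]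
  have hI : Complex.I * Complex.I = -1 := Complex.I_mul_I
  rw [IsNilpotent.exp_eq_sum he]
  simp only [Finset.sum_range_succ, Finset.sum_range_zero, Nat.factorial, pow_succ, pow_zero,
    one_mul, zero_add, Module.End.mul_apply, LinearMap.add_apply, LinearMap.smul_apply,
    Module.End.one_apply, map_smul, smul_smul, hI]
  simp only [ad_eElt_apply, Prod.smul_mk, Prod.mk_add_mk, L_mulVec, jmul_unitJ,
    Matrix.smul_mulVec]
  refine Prod.ext ?_ (Prod.ext ?_ ?_)
  · simp
  · simp [← Rat.cast_smul_eq_qsmul ℂ]; module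
  · simp [← Rat.cast_smul_eq_qsmul ℂ]; module

/-- Derivations annihilate the units `e` and `f`, so `d` is untouched. For `a = 0` and `x = -u` both
outer components vanish: this is how `𝔨` lands in the structure algebra. -/
theorem cayley_elt (α : ℂ) (u a : J) (d : Fin 5 → ℂ) (x : J) :
    cayley α (elt α u a d x) =
      elt α ((1 / 4 : ℂ) • (u + x + Complex.I • a)) (Complex.I • (u - x)) d
        (u + x - Complex.I • a) := by
  rw [cayley, Module.End.mul_apply, elt, exp_ad_eElt_apply, exp_ad_fElt_apply,
    Matrix.add_mulVec _ _ unitJ, Matrix.smul_mulVec, L_mulVec, jmul_unitJ, elt_mulVec_unitJ, elt]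
  have hI : Complex.I * Complex.I = -1 := Complex.I_mul_I
  refine Prod.ext ?_ (Prod.ext ?_ ?_)
  · ext i
    simp only [Pi.add_apply, Pi.smul_apply, Pi.sub_apply, smul_eq_mul]
    linear_combination (u i) * hI
  · simp only [map_add, map_sub, map_smul, smul_add, smul_sub, smul_smul, hI]
    module
  · dsimp only; abel

/-- Both sides are explicit in the coordinates and agree by `i² = -1`; no general fact about
exponentials of derivations is needed. -/
theorem cayley_bracket_elt (α : ℂ) (u a x u' a' x' : J) (d d' : Fin 5 → ℂ) :
    cayley α (bracket α (elt α u a d x) (elt α u' a' d' x')) =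
      bracket α (cayley α (elt α u a d x)) (cayley α (elt α u' a' d' x')) := by
  have hI : Complex.I ^ 2 = -1 := Complex.I_sq
  rw [bracket_elt, cayley_elt, cayley_elt, cayley_elt, bracket_elt]
  congr 1
  · ext i
    fin_cases i <;> simp [jmul, dmat_mulVec, sder] <;> grind
  · ext i
    fin_cases i <;> simp [jmul, dmat_mulVec, sder] <;> grind
  · ext i
    fin_cases i <;> simp [inn, dbr] <;> grind
  · ext i
    fin_cases i <;> simp [jmul, dmat_mulVec, sder] <;> grind

section

open MvPolynomial (C X pderiv)

/-! ## The three blocks of `π_λ` -/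

namespace SuperPoly

theorem sub_a (p q : SuperPoly) : (p - q).a = p.a - q.a := by
  rw [sub_eq_add_neg, add_a, neg_a, sub_eq_add_neg]

theorem sub_b (p q : SuperPoly) : (p - q).b = p.b - q.b := by
  rw [sub_eq_add_neg, add_b, neg_b, sub_eq_add_neg]

theorem sub_c (p q : SuperPoly) : (p - q).c = p.c - q.c := by
  rw [sub_eq_add_neg, add_c, neg_c, sub_eq_add_neg]

theorem sub_d (p q : SuperPoly) : (p - q).d = p.d - q.d := by
  rw [sub_eq_add_neg, add_d, neg_d, sub_eq_add_neg]

end SuperPoly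

/-- Multiplication by the linear form `u`. -/
def mU (u : J) : Module.End ℂ SuperPoly := ∑ i, u i • mulZ i

/-- The action of `L_a + D` by first order differential operators, for `λ = α ν`. -/
def mT (α ν : ℂ) (a : J) (d : Fin 5 → ℂ) : Module.End ℂ SuperPoly :=
  ((α * ν * a 0 + ν * a 1) / 2) • 1
    + ∑ j, ∑ i, (L α (-a) + dmat α d) i j • (mulZ i * partialD j)

/-- The Bessel operator at `x`, for `λ = α ν`. -/
def mX (α ν : ℂ) (x : J) : Module.End ℂ SuperPoly := ∑ i, x i • bessel α (α * ν) i

/-- Writing `λ = αν` replaces the quotient `λ/α` by `ν`, so the later identities are polynomial in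
`α` and `ν`. -/
theorem piRep_elt {α : ℂ} (hα : α ≠ 0) (ν : ℂ) (u a : J) (d : Fin 5 → ℂ) (x : J) :
    piRep α (α * ν) (elt α u a d x) =
      (-2 * Complex.I) • mU u + mT α ν a d + (-(Complex.I / 2)) • mX α ν x := by
  rw [piRep, elt, mU, mT, mX, character, elt_mulVec_unitJ, minusAct_elt,
    mul_div_cancel_left₀ ν hα]

section Components

variable (α ν : ℂ) (p : SuperPoly)

theorem mU_a (u : J) : (mU u p).a = (C (u 0) * X 0 + C (u 1) * X 1) * p.a := by
  simp [mU, Fin.sum_univ_four, mulZ, z, MvPolynomial.smul_eq_C_mul]; ring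

theorem mU_b (u : J) :
    (mU u p).b = (C (u 0) * X 0 + C (u 1) * X 1) * p.b + C (u 2) * p.a := by
  simp [mU, Fin.sum_univ_four, mulZ, z, MvPolynomial.smul_eq_C_mul]; ring

theorem mU_c (u : J) :
    (mU u p).c = (C (u 0) * X 0 + C (u 1) * X 1) * p.c + C (u 3) * p.a := by
  simp [mU, Fin.sum_univ_four, mulZ, z, MvPolynomial.smul_eq_C_mul]; ring

theorem mU_d (u : J) : (mU u p).d =
    (C (u 0) * X 0 + C (u 1) * X 1) * p.d + C (u 2) * p.c - C (u 3) * p.b := by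
  simp [mU, Fin.sum_univ_four, mulZ, z, MvPolynomial.smul_eq_C_mul]; ring

/-- Doubling `a` clears the halves in the Jordan product, leaving polynomial entries that ring
normalization can handle. -/
theorem mT_two_smul (a : J) (d : Fin 5 → ℂ) : mT α ν ((2 : ℂ) • a) d =
    (α * ν * a 0 + ν * a 1) • 1 + ∑ j, ∑ i,
      !![-2 * a 0, 0, 2 * (a 3 + d 4), -2 * (a 2 + d 3);
         0, -2 * a 1, 2 * α * (a 3 - d 4), -2 * α * (a 2 - d 3);
         d 3 - a 2, -d 3 - a 2, d 0 - a 0 - a 1, d 1;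
         d 4 - a 3, -d 4 - a 3, d 2, -d 0 - a 0 - a 1] i j • (mulZ i * partialD j) := by
  have h : L α (-((2 : ℂ) • a)) + dmat α d =
      !![-2 * a 0, 0, 2 * (a 3 + d 4), -2 * (a 2 + d 3);
         0, -2 * a 1, 2 * α * (a 3 - d 4), -2 * α * (a 2 - d 3);
         d 3 - a 2, -d 3 - a 2, d 0 - a 0 - a 1, d 1;
         d 4 - a 3, -d 4 - a 3, d 2, -d 0 - a 0 - a 1] := by
    rw [L_eq]
    ext i j
    fin_cases i <;> fin_cases j <;> simp [dmat] <;> ring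
  rw [mT, h]
  congr 2
  simp; ring

/-- The degree operator twisted by `a`, common to all components of `mT`. -/
def eulerPart (a : J) (f : MvPolynomial (Fin 2) ℂ) : MvPolynomial (Fin 2) ℂ :=
  (C α * C ν * C (a 0) + C ν * C (a 1)) * f
    - 2 * C (a 0) * (X 0 * pderiv 0 f) - 2 * C (a 1) * (X 1 * pderiv 1 f)

theorem mT_a (a : J) (d : Fin 5 → ℂ) : (mT α ν ((2 : ℂ) • a) d p).a = eulerPart α ν a p.a
    + 2 * ((C (a 3) + C (d 4)) * X 0 + C α * (C (a 3) - C (d 4)) * X 1) * p.b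
    - 2 * ((C (a 2) + C (d 3)) * X 0 + C α * (C (a 2) - C (d 3)) * X 1) * p.c := by
  rw [mT_two_smul]
  simp [eulerPart, Fin.sum_univ_four, mulZ, z, MvPolynomial.smul_eq_C_mul, partialD, evenDeriv,
    oddDeriv₃, oddDeriv₄, map_ofNat]
  ring

theorem mT_b (a : J) (d : Fin 5 → ℂ) : (mT α ν ((2 : ℂ) • a) d p).b = eulerPart α ν a p.b
    + (C (d 3) - C (a 2)) * pderiv 0 p.a - (C (d 3) + C (a 2)) * pderiv 1 p.a
    + (C (d 0) - C (a 0) - C (a 1)) * p.b + C (d 1) * p.c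
    + 2 * ((C (a 2) + C (d 3)) * X 0 + C α * (C (a 2) - C (d 3)) * X 1) * p.d := by
  rw [mT_two_smul]
  simp [eulerPart, Fin.sum_univ_four, mulZ, z, MvPolynomial.smul_eq_C_mul, partialD, evenDeriv,
    oddDeriv₃, oddDeriv₄, map_ofNat]
  ring

theorem mT_c (a : J) (d : Fin 5 → ℂ) : (mT α ν ((2 : ℂ) • a) d p).c = eulerPart α ν a p.c
    + (C (d 4) - C (a 3)) * pderiv 0 p.a - (C (d 4) + C (a 3)) * pderiv 1 p.a
    + C (d 2) * p.b - (C (d 0) + C (a 0) + C (a 1)) * p.c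
    + 2 * ((C (a 3) + C (d 4)) * X 0 + C α * (C (a 3) - C (d 4)) * X 1) * p.d := by
  rw [mT_two_smul]
  simp [eulerPart, Fin.sum_univ_four, mulZ, z, MvPolynomial.smul_eq_C_mul, partialD, evenDeriv,
    oddDeriv₃, oddDeriv₄, map_ofNat]
  ring

theorem mT_d (a : J) (d : Fin 5 → ℂ) : (mT α ν ((2 : ℂ) • a) d p).d = eulerPart α ν a p.d
    + (C (d 3) - C (a 2)) * pderiv 0 p.c - (C (d 3) + C (a 2)) * pderiv 1 p.c
    - (C (d 4) - C (a 3)) * pderiv 0 p.b + (C (d 4) + C (a 3)) * pderiv 1 p.b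
    - 2 * (C (a 0) + C (a 1)) * p.d := by
  rw [mT_two_smul]
  simp [eulerPart, Fin.sum_univ_four, mulZ, z, MvPolynomial.smul_eq_C_mul, partialD, evenDeriv,
    oddDeriv₃, oddDeriv₄, map_ofNat]
  ring

theorem mX_a (hα : α ≠ 0) (x : J) : (mX α ν x p).a =
    C (x 0) * (X 0 * pderiv 0 (pderiv 0 p.a) + (0 - C α * C ν) * pderiv 0 p.a + 2 * C α * X 1 * p.d)
    + C (x 1) * (X 1 * pderiv 1 (pderiv 1 p.a) + (0 - C ν) * pderiv 1 p.a + 2 * X 0 * p.d)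
    + 2 * C (x 2) * (X 0 * pderiv 0 p.c + C α * X 1 * pderiv 1 p.c - C α * C ν * p.c)
    - 2 * C (x 3) * (X 0 * pderiv 0 p.b + C α * X 1 * pderiv 1 p.b - C α * C ν * p.b) := by
  simp [mX, bessel, Fin.sum_univ_four, mulZ, z, MvPolynomial.smul_eq_C_mul, partialD, evenDeriv,
    oddDeriv₃, oddDeriv₄, map_ofNat, sub_a, mul_div_cancel_left₀ ν hα]
  ring

theorem mX_b (hα : α ≠ 0) (x : J) : (mX α ν x p).b =
    C (x 0) * (X 0 * pderiv 0 (pderiv 0 p.b) + (1 - C α * C ν) * pderiv 0 p.b)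
    + C (x 1) * (X 1 * pderiv 1 (pderiv 1 p.b) + (1 - C ν) * pderiv 1 p.b)
    + C (x 2) * (-2 * (X 0 * pderiv 0 p.d + C α * X 1 * pderiv 1 p.d - C α * C ν * p.d)
      - 2 * (1 + C α) * p.d + pderiv 0 (pderiv 1 p.a)) := by
  simp [mX, bessel, Fin.sum_univ_four, mulZ, z, MvPolynomial.smul_eq_C_mul, partialD, evenDeriv,
    oddDeriv₃, oddDeriv₄, map_ofNat, sub_b, mul_div_cancel_left₀ ν hα]
  ring

theorem mX_c (hα : α ≠ 0) (x : J) : (mX α ν x p).c =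
    C (x 0) * (X 0 * pderiv 0 (pderiv 0 p.c) + (1 - C α * C ν) * pderiv 0 p.c)
    + C (x 1) * (X 1 * pderiv 1 (pderiv 1 p.c) + (1 - C ν) * pderiv 1 p.c)
    + C (x 3) * (-2 * (X 0 * pderiv 0 p.d + C α * X 1 * pderiv 1 p.d - C α * C ν * p.d)
      - 2 * (1 + C α) * p.d + pderiv 0 (pderiv 1 p.a)) := by
  simp [mX, bessel, Fin.sum_univ_four, mulZ, z, MvPolynomial.smul_eq_C_mul, partialD, evenDeriv,
    oddDeriv₃, oddDeriv₄, map_ofNat, sub_c, mul_div_cancel_left₀ ν hα]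
  ring

theorem mX_d (hα : α ≠ 0) (x : J) : (mX α ν x p).d =
    C (x 0) * (X 0 * pderiv 0 (pderiv 0 p.d) + (2 - C α * C ν) * pderiv 0 p.d)
    + C (x 1) * (X 1 * pderiv 1 (pderiv 1 p.d) + (2 - C ν) * pderiv 1 p.d)
    + C (x 2) * pderiv 0 (pderiv 1 p.c) - C (x 3) * pderiv 0 (pderiv 1 p.b) := by
  simp [mX, bessel, Fin.sum_univ_four, mulZ, z, MvPolynomial.smul_eq_C_mul, partialD, evenDeriv,
    oddDeriv₃, oddDeriv₄, sub_d, mul_div_cancel_left₀ ν hα]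
  ring

end Components

end

section

open MvPolynomial (C X pderiv)

/-! ## Supercommutators of the blocks -/

/-- Homogeneous vectors of `D_α` of parity `p`. -/
def hJ (p : Fin 2) (v : Fin 2 → ℂ) : J := ![![v 0, v 1, 0, 0], ![0, 0, v 0, v 1]] p

/-- Parameters of homogeneous derivations of parity `p`. -/
def hD (p : Fin 2) (w : Fin 3 → ℂ) : Fin 5 → ℂ :=
  ![![w 0, w 1, w 2, 0, 0], ![0, 0, 0, w 0, w 1]] p

/-- The sign `(-1)^{pq}`. -/
def sgn (p q : Fin 2) : ℂ := (-1) ^ ((p : ℕ) * (q : ℕ))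

/-- A commutator of derivations is a derivation, and this one vanishes on the variables. -/
theorem pderiv_one_pderiv_zero (f : MvPolynomial (Fin 2) ℂ) :
    pderiv 1 (pderiv 0 f) = pderiv 0 (pderiv 1 f) := by
  have h : ⁅pderiv (R := ℂ) (1 : Fin 2), pderiv (R := ℂ) (0 : Fin 2)⁆ = 0 := by
    refine MvPolynomial.derivation_ext fun i => ?_
    fin_cases i <;> simp [Derivation.commutator_apply]
  have := congrArg (fun D => D f) h
  simpa [Derivation.commutator_apply, sub_eq_zero] using this

theorem pderiv_two (i : Fin 2) : pderiv i (2 : MvPolynomial (Fin 2) ℂ) = 0 := by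
  simpa using (pderiv (R := ℂ) i).map_natCast 2

theorem jmul_two_smul_left (α : ℂ) (x y : J) : jmul α ((2 : ℂ) • x) y =
    ![2 * (x 0 * y 0 + (x 2 * y 3 - x 3 * y 2)),
      2 * (x 1 * y 1 + α * (x 2 * y 3 - x 3 * y 2)),
      (x 0 + x 1) * y 2 + x 2 * (y 0 + y 1), (x 0 + x 1) * y 3 + x 3 * (y 0 + y 1)] := by
  ext i; fin_cases i <;> simp [jmul] <;> ring

theorem two_smul_inn_two_smul_left (α : ℂ) (a b : J) :
    (2 : ℂ) • inn α ((2 : ℂ) • a) b =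
      ![-2 * (1 + α) * (a 2 * b 3 + a 3 * b 2), 4 * (1 + α) * (a 2 * b 2),
        -4 * (1 + α) * (a 3 * b 3), a 2 * (b 0 - b 1) - (a 0 - a 1) * b 2,
        a 3 * (b 0 - b 1) - (a 0 - a 1) * b 3] := by
  ext i; fin_cases i <;> simp [inn] <;> ring

theorem inn_two_smul_two_smul (α : ℂ) (a b : J) :
    inn α ((2 : ℂ) • a) ((2 : ℂ) • b) =
      ![-2 * (1 + α) * (a 2 * b 3 + a 3 * b 2), 4 * (1 + α) * (a 2 * b 2),
        -4 * (1 + α) * (a 3 * b 3), a 2 * (b 0 - b 1) - (a 0 - a 1) * b 2,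
        a 3 * (b 0 - b 1) - (a 0 - a 1) * b 3] := by
  ext i; fin_cases i <;> simp [inn] <;> ring

/-- For homogeneous arguments the sign is one scalar. This and the following supercommutators are
then checked for each pair of parities on the four components of a superpolynomial. -/
theorem mU_supercomm (p q : Fin 2) (v w : Fin 2 → ℂ) :
    mU (hJ p v) * mU (hJ q w) = sgn p q • (mU (hJ q w) * mU (hJ p v)) := by
  refine LinearMap.ext fun f => ?_
  fin_cases p <;> fin_cases q <;> ext1 <;>
    simp [sgn, hJ, mU_a, mU_b, mU_c, mU_d] <;> ring

theorem mT_mU_supercomm (α ν : ℂ) (p q : Fin 2) (a v : Fin 2 → ℂ) (d : Fin 3 → ℂ) :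
    mT α ν ((2 : ℂ) • hJ p a) (hD p d) * mU (hJ q v)
      - sgn p q • (mU (hJ q v) * mT α ν ((2 : ℂ) • hJ p a) (hD p d)) =
    mU (-jmul α ((2 : ℂ) • hJ p a) (hJ q v) + dmat α (hD p d) *ᵥ hJ q v) := by
  refine LinearMap.ext fun f => ?_
  rw [jmul_two_smul_left, dmat_mulVec]
  fin_cases p <;> fin_cases q <;> ext1 <;>
    simp only [mU_a, mU_b, mU_c, mU_d, mT_a, mT_b, mT_c, mT_d, eulerPart, sub_a, sub_b,
      sub_c, sub_d, smul_a, smul_b, smul_c, smul_d, LinearMap.sub_apply, LinearMap.smul_apply,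
      Module.End.mul_apply] <;>
    simp [sgn, hJ, hD, map_ofNat] <;> ring

-- The operator form of `[x, u] = 2 L_{xu} + 2 [L_x, L_u]`. The minus sign is compensated by the
-- normalizations of `π_λ` on `D⁺` and `D⁻`, whose product is `-1`.
set_option maxHeartbeats 4000000 in
theorem mX_mU_supercomm {α : ℂ} (hα : α ≠ 0) (ν : ℂ) (p q : Fin 2) (x v : Fin 2 → ℂ) :
    mX α ν ((2 : ℂ) • hJ p x) * mU (hJ q v)
      - sgn p q • (mU (hJ q v) * mX α ν ((2 : ℂ) • hJ p x)) =
    -mT α ν ((2 : ℂ) • jmul α ((2 : ℂ) • hJ p x) (hJ q v))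
      ((2 : ℂ) • inn α ((2 : ℂ) • hJ p x) (hJ q v)) := by
  refine LinearMap.ext fun f => ?_
  rw [jmul_two_smul_left, two_smul_inn_two_smul_left]
  fin_cases p <;> fin_cases q <;> ext1 <;>
    simp only [mU_a, mU_b, mU_c, mU_d, mT_a, mT_b, mT_c, mT_d, eulerPart, sub_a, sub_b,
      sub_c, sub_d, smul_a, smul_b, smul_c, smul_d, LinearMap.sub_apply, LinearMap.smul_apply,
      LinearMap.neg_apply, neg_a, neg_b, neg_c, neg_d, mX_a _ _ _ hα, mX_b _ _ _ hα,
      mX_c _ _ _ hα, mX_d _ _ _ hα, Module.End.mul_apply] <;>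
    simp [sgn, hJ, map_ofNat] <;> ring

set_option maxHeartbeats 4000000 in
theorem mT_supercomm (α ν : ℂ) (p q : Fin 2) (a a' : Fin 2 → ℂ) (d d' : Fin 3 → ℂ) :
    mT α ν ((2 : ℂ) • hJ p a) (hD p d) * mT α ν ((2 : ℂ) • hJ q a') (hD q d')
      - sgn p q • (mT α ν ((2 : ℂ) • hJ q a') (hD q d') * mT α ν ((2 : ℂ) • hJ p a) (hD p d)) =
    mT α ν ((2 : ℂ) • (dmat α (hD p d) *ᵥ hJ q a' - sder α (hD q d') (hJ p a)))
      (inn α ((2 : ℂ) • hJ p a) ((2 : ℂ) • hJ q a') + dbr α (hD p d) (hD q d')) := by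
  refine LinearMap.ext fun f => ?_
  rw [inn_two_smul_two_smul, dmat_mulVec]
  fin_cases p <;> fin_cases q <;> ext1 <;>
    simp only [mT_a, mT_b, mT_c, mT_d, eulerPart, sub_a, sub_b,
      sub_c, sub_d, smul_a, smul_b, smul_c, smul_d, LinearMap.sub_apply, LinearMap.smul_apply,
      Module.End.mul_apply] <;>
    simp [sgn, hJ, hD, dbr, sder, map_ofNat, pderiv_one_pderiv_zero, pderiv_two] <;> ring

set_option maxHeartbeats 4000000 in
theorem mT_mX_supercomm {α : ℂ} (hα : α ≠ 0) (ν : ℂ) (p q : Fin 2) (a x : Fin 2 → ℂ)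
    (d : Fin 3 → ℂ) :
    mT α ν ((2 : ℂ) • hJ p a) (hD p d) * mX α ν (hJ q x)
      - sgn p q • (mX α ν (hJ q x) * mT α ν ((2 : ℂ) • hJ p a) (hD p d)) =
    mX α ν (jmul α ((2 : ℂ) • hJ p a) (hJ q x) + dmat α (hD p d) *ᵥ hJ q x) := by
  refine LinearMap.ext fun f => ?_
  rw [jmul_two_smul_left, dmat_mulVec]
  fin_cases p <;> fin_cases q <;> ext1 <;>
    simp only [mX_a _ _ _ hα, mX_b _ _ _ hα,
      mX_c _ _ _ hα, mX_d _ _ _ hα, mT_a, mT_b, mT_c, mT_d, eulerPart, sub_a, sub_b,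
      sub_c, sub_d, smul_a, smul_b, smul_c, smul_d, LinearMap.sub_apply, LinearMap.smul_apply,
      Module.End.mul_apply] <;>
    simp [sgn, hJ, hD, map_ofNat, pderiv_one_pderiv_zero, pderiv_two] <;> ring

set_option maxHeartbeats 4000000 in
theorem mX_supercomm {α : ℂ} (hα : α ≠ 0) (ν : ℂ) (p q : Fin 2) (x y : Fin 2 → ℂ) :
    mX α ν (hJ p x) * mX α ν (hJ q y) = sgn p q • (mX α ν (hJ q y) * mX α ν (hJ p x)) := by
  refine LinearMap.ext fun f => ?_
  fin_cases p <;> fin_cases q <;> ext1 <;>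
    simp only [mX_a _ _ _ hα, mX_b _ _ _ hα, mX_c _ _ _ hα, mX_d _ _ _ hα,
      smul_a, smul_b, smul_c, smul_d, LinearMap.smul_apply, Module.End.mul_apply] <;>
    simp [sgn, hJ, pderiv_one_pderiv_zero, pderiv_two] <;> ring

end

/-! ## `π_λ` and `ρ_λ` are representations -/

theorem hJ_smul (p : Fin 2) (t : ℂ) (v : Fin 2 → ℂ) : hJ p (t • v) = t • hJ p v := by
  ext i; fin_cases p <;> fin_cases i <;> simp [hJ]

theorem hJ_add (p : Fin 2) (v w : Fin 2 → ℂ) : hJ p (v + w) = hJ p v + hJ p w := by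
  ext i; fin_cases p <;> fin_cases i <;> simp [hJ]

theorem hJ_sub (p : Fin 2) (v w : Fin 2 → ℂ) : hJ p (v - w) = hJ p v - hJ p w := by
  ext i; fin_cases p <;> fin_cases i <;> simp [hJ]

theorem two_smul_half_smul {M : Type*} [AddCommGroup M] [Module ℂ M] (v : M) :
    (2 : ℂ) • (1 / 2 : ℂ) • v = v := by
  rw [smul_smul]; norm_num

theorem sder_smul (α t : ℂ) (d : Fin 5 → ℂ) (x : J) : sder α d (t • x) = t • sder α d x := by
  ext i; fin_cases i <;> simp [sder] <;> ring

theorem sder_hJ (α : ℂ) (p q : Fin 2) (d : Fin 3 → ℂ) (v : Fin 2 → ℂ) :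
    sder α (hD p d) (hJ q v) = sgn q p • (dmat α (hD p d) *ᵥ hJ q v) := by
  rw [dmat_mulVec]
  ext i; fin_cases p <;> fin_cases q <;> fin_cases i <;> simp [sder, sgn, hD, hJ]

theorem jmul_hJ_comm (α : ℂ) (p q : Fin 2) (v w : Fin 2 → ℂ) :
    jmul α (hJ p v) (hJ q w) = sgn p q • jmul α (hJ q w) (hJ p v) := by
  ext i; fin_cases p <;> fin_cases q <;> fin_cases i <;> simp [sgn, jmul, hJ] <;> ring

theorem inn_hJ_comm (α : ℂ) (p q : Fin 2) (v w : Fin 2 → ℂ) :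
    inn α (hJ p v) (hJ q w) = -(sgn p q • inn α (hJ q w) (hJ p v)) := by
  ext i; fin_cases p <;> fin_cases q <;> fin_cases i <;> 
    simp [sgn, inn, hJ, -mul_eq_mul_left_iff, -mul_eq_mul_right_iff] <;> ring

theorem sgn_comm (p q : Fin 2) : sgn p q = sgn q p := by
  rw [sgn, sgn, mul_comm]

theorem sgn_mul_self (p q : Fin 2) : sgn p q * sgn p q = 1 := by
  fin_cases p <;> fin_cases q <;> simp [sgn]

theorem mU_add (u v : J) : mU (u + v) = mU u + mU v := by
  simp [mU, add_smul, Finset.sum_add_distrib]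

theorem mU_smul (t : ℂ) (u : J) : mU (t • u) = t • mU u := by
  simp [mU, Finset.smul_sum, smul_smul]

theorem mX_add (α ν : ℂ) (u v : J) : mX α ν (u + v) = mX α ν u + mX α ν v := by
  simp [mX, add_smul, Finset.sum_add_distrib]

theorem mX_smul (α ν t : ℂ) (u : J) : mX α ν (t • u) = t • mX α ν u := by
  simp [mX, Finset.smul_sum, smul_smul]

theorem mT_add (α ν : ℂ) (a a' : J) (d d' : Fin 5 → ℂ) :
    mT α ν (a + a') (d + d') = mT α ν a d + mT α ν a' d' := by
  simp only [mT, neg_add, map_add, dmat_add, Matrix.add_apply, add_smul, Finset.sum_add_distrib,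
    Pi.add_apply]
  module

theorem mT_smul (α ν t : ℂ) (a : J) (d : Fin 5 → ℂ) :
    mT α ν (t • a) (t • d) = t • mT α ν a d := by
  rw [mT, mT, ← smul_neg, map_smul, dmat_smul, ← smul_add]
  simp only [Matrix.smul_apply, smul_eq_mul, mul_smul, ← Finset.smul_sum, smul_add, Pi.smul_apply]
  congr 1
  module

/-- Bilinearity reduces the claim to the supercommutators of the blocks. The terms in which the
second argument supplies the left-hand block are brought to standard order by super-skewsymmetry, at
the cost of the factor `-sgn p q`. -/
theorem piRep_bracket {α : ℂ} (hα : α ≠ 0) (ν : ℂ) (p q : Fin 2) (u a x u' a' x' : Fin 2 → ℂ)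
    (d d' : Fin 3 → ℂ) :
    piRep α (α * ν) (bracket α (elt α (hJ p u) (hJ p a) (hD p d) (hJ p x))
        (elt α (hJ q u') (hJ q a') (hD q d') (hJ q x'))) =
      piRep α (α * ν) (elt α (hJ p u) (hJ p a) (hD p d) (hJ p x))
          * piRep α (α * ν) (elt α (hJ q u') (hJ q a') (hD q d') (hJ q x'))
        - sgn p q • (piRep α (α * ν) (elt α (hJ q u') (hJ q a') (hD q d') (hJ q x'))
          * piRep α (α * ν) (elt α (hJ p u) (hJ p a) (hD p d) (hJ p x))) := by
  have hUU := mU_supercomm p q u u'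
  have hXX := mX_supercomm hα ν p q x x'
  have hTU := mT_mU_supercomm α ν p q ((1 / 2 : ℂ) • a) u' d
  have hUT := mT_mU_supercomm α ν q p ((1 / 2 : ℂ) • a') u d'
  have hTX := mT_mX_supercomm hα ν p q ((1 / 2 : ℂ) • a) x' d
  have hXT := mT_mX_supercomm hα ν q p ((1 / 2 : ℂ) • a') x d'
  have hXU := mX_mU_supercomm hα ν p q ((1 / 2 : ℂ) • x) u'
  have hUX := mX_mU_supercomm hα ν q p ((1 / 2 : ℂ) • x') u
  have hTT := mT_supercomm α ν p q ((1 / 2 : ℂ) • a) ((1 / 2 : ℂ) • a') d d'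
  have hε := sgn_mul_self p q
  simp only [hJ_smul, two_smul_half_smul, Matrix.mulVec_smul, sder_smul, smul_sub, mT_smul,
    sgn_comm q p] at hTU hUT hTX hXT hXU hUX hTT
  -- This product is all that is needed of the two normalizing constants, so both can be
  -- generalized.
  have hc : (-2 * Complex.I) * (-(Complex.I / 2)) = -1 := by linear_combination Complex.I_sq
  rw [bracket_elt, piRep_elt hα, piRep_elt hα, piRep_elt hα]
  generalize -2 * Complex.I = c at *
  generalize -(Complex.I / 2) = c' at *
  have e1 : -jmul α (hJ p a) (hJ q u') + dmat α (hD p d) *ᵥ hJ q u' + jmul α (hJ p u) (hJ q a')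
        - sder α (hD q d') (hJ p u) =
      (-jmul α (hJ p a) (hJ q u') + dmat α (hD p d) *ᵥ hJ q u')
        + (-sgn p q) • (-jmul α (hJ q a') (hJ p u) + dmat α (hD q d') *ᵥ hJ p u) := by
    rw [jmul_hJ_comm α p q u a', sder_hJ]; module
  have e2 : jmul α (hJ p a) (hJ q x') + dmat α (hD p d) *ᵥ hJ q x' - jmul α (hJ p x) (hJ q a')
        - sder α (hD q d') (hJ p x) =
      (jmul α (hJ p a) (hJ q x') + dmat α (hD p d) *ᵥ hJ q x')
        + (-sgn p q) • (jmul α (hJ q a') (hJ p x) + dmat α (hD q d') *ᵥ hJ p x) := by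
    rw [jmul_hJ_comm α p q x a', sder_hJ]; module
  have e3 : dmat α (hD p d) *ᵥ hJ q a' - sder α (hD q d') (hJ p a)
        + (2 : ℂ) • jmul α (hJ p x) (hJ q u') - (2 : ℂ) • jmul α (hJ p u) (hJ q x') =
      (dmat α (hD p d) *ᵥ hJ q a' - sder α (hD q d') (hJ p a))
        + (2 : ℂ) • jmul α (hJ p x) (hJ q u')
        + (-sgn p q) • (2 : ℂ) • jmul α (hJ q x') (hJ p u) := by
    rw [jmul_hJ_comm α p q u x']; module
  have e4 : inn α (hJ p a) (hJ q a') + dbr α (hD p d) (hD q d')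
        + (2 : ℂ) • inn α (hJ p x) (hJ q u') + (2 : ℂ) • inn α (hJ p u) (hJ q x') =
      (inn α (hJ p a) (hJ q a') + dbr α (hD p d) (hD q d'))
        + (2 : ℂ) • inn α (hJ p x) (hJ q u')
        + (-sgn p q) • (2 : ℂ) • inn α (hJ q x') (hJ p u) := by
    rw [inn_hJ_comm α p q u x']; module
  rw [e1, e2, e3, e4, mU_add, mU_smul, mX_add, mX_smul, mT_add, mT_add]
  simp only [mT_smul]
  rw [← hTU, ← hUT, ← hTX, ← hXT, ← hTT]
  rw [← neg_eq_iff_eq_neg] at hXU hUX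
  rw [← hXU, ← hUX]
  simp only [add_mul, mul_add, smul_mul_assoc, mul_smul_comm, hUU, hXX]
  generalize sgn p q = ε at *
  set U := mU (hJ p u)
  set U' := mU (hJ q u')
  set X := mX α ν (hJ p x)
  set X' := mX α ν (hJ q x')
  -- With `ε = ±1` explicit, only the mixed products of multiplications and Bessel operators remain,
  -- each carrying the factor `cc' = -1`.
  obtain rfl | rfl := mul_self_eq_one_iff.1 hε
  · linear_combination (norm := module) hc • (-(X * U') + U' * X + X' * U - U * X')
  · linear_combination (norm := module) hc • (-(X * U') - U' * X - X' * U - U * X')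

theorem mem_g_homogeneous {K : Subfield ℂ} {α : ℂ} {p : Fin 2} {X : Triple} (hX : X ∈ g K α)
    (hp : HasParity p X) :
    ∃ u a d x, X = elt α (hJ p u) (hJ p a) (hD p d) (hJ p x) := by
  obtain ⟨u, a, d, x, rfl⟩ := exists_elt_of_mem_gC (Submodule.mem_inf.1 hX).1
  obtain ⟨hu, hT, hx⟩ := hp
  simp only [elt, L_eq, dmat, Fin.forall_fin_succ] at hu hT hx
  fin_cases p
  · simp [par] at hu hT hx
    refine ⟨![u 0, u 1], ![a 0, a 1], ![d 0, d 1, d 2], ![x 0, x 1], ?_⟩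
    congr 1 <;> ext i <;> fin_cases i <;> simp [hJ, hD] <;> grind
  · simp [par] at hu hT hx
    refine ⟨![u 2, u 3], ![a 2, a 3], ![d 3, d 4, 0], ![x 2, x 3], ?_⟩
    congr 1 <;> ext i <;> fin_cases i <;> simp [hJ, hD] <;> grind

theorem rho_bracket {K : Subfield ℂ} {α : ℂ} (hα : α ≠ 0) (ν : ℂ) {p q : Fin 2} {X Y : Triple}
    (hX : X ∈ g K α) (hY : Y ∈ g K α) (hp : HasParity p X) (hq : HasParity q Y) :
    rho α (α * ν) (bracket α X Y) =
      rho α (α * ν) X * rho α (α * ν) Y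
        - ((-1 : ℂ) ^ ((p : ℕ) * (q : ℕ))) • (rho α (α * ν) Y * rho α (α * ν) X) := by
  obtain ⟨u, a, d, x, rfl⟩ := mem_g_homogeneous hX hp
  obtain ⟨u', a', d', x', rfl⟩ := mem_g_homogeneous hY hq
  simp only [rho, cayley_bracket_elt]
  -- The Cayley transform is built from linear combinations of `u, a, x`, so it preserves parity.
  simp only [cayley_elt, ← hJ_smul, ← hJ_add, ← hJ_sub]
  exact piRep_bracket hα ν p q _ _ _ _ _ _ _ _

/-! ### Rationality over the subfield `K` -/

section Rationality

variable {K : Subfield ℂ}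

theorem mulVec_mem {T : EndJ} {u : J} (hT : ∀ i j, T i j ∈ K) (hu : ∀ i, u i ∈ K) (i : Fin 4) :
    (T *ᵥ u) i ∈ K := by
  simp only [Matrix.mulVec, dotProduct]
  exact sum_mem fun j _ => mul_mem (hT i j) (hu j)

theorem signedApply_mem {T : EndJ} {u : J} (hT : ∀ i j, T i j ∈ K) (hu : ∀ i, u i ∈ K)
    (i : Fin 4) : signedApply T u i ∈ K :=
  sum_mem fun j _ => mul_mem (pow_mem (neg_mem (one_mem K)) _) (mul_mem (hT i j) (hu j))

theorem superComm_mem {S T : EndJ} (hS : ∀ i j, S i j ∈ K) (hT : ∀ i j, T i j ∈ K)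
    (i j : Fin 4) : superComm S T i j ∈ K := by
  simp only [superComm, Matrix.of_apply]
  exact sum_mem fun l _ => sub_mem (mul_mem (hS i l) (hT l j))
    (mul_mem (pow_mem (neg_mem (one_mem K)) _) (mul_mem (hT i l) (hS l j)))

theorem two_mem : (2 : ℂ) ∈ K := ofNat_mem K 2

theorem unitJ_mem (i : Fin 4) : unitJ i ∈ K := by
  fin_cases i <;> simp [unitJ, zero_mem, one_mem]

theorem jmul_mem {α : ℂ} (hα : α ∈ K) {x y : J} (hx : ∀ i, x i ∈ K) (hy : ∀ i, y i ∈ K)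
    (i : Fin 4) : jmul α x y i ∈ K := by
  have h2 : (2 : ℂ) ∈ K := two_mem
  have h : x 2 * y 3 - x 3 * y 2 ∈ K :=
    sub_mem (mul_mem (hx 2) (hy 3)) (mul_mem (hx 3) (hy 2))
  fin_cases i
  · exact add_mem (mul_mem (hx 0) (hy 0)) h
  · exact add_mem (mul_mem (hx 1) (hy 1)) (mul_mem hα h)
  · exact div_mem (add_mem (mul_mem (add_mem (hx 0) (hx 1)) (hy 2))
      (mul_mem (hx 2) (add_mem (hy 0) (hy 1)))) h2
  · exact div_mem (add_mem (mul_mem (add_mem (hx 0) (hx 1)) (hy 3))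
      (mul_mem (hx 3) (add_mem (hy 0) (hy 1)))) h2

theorem L_mem {α : ℂ} (hα : α ∈ K) {x : J} (hx : ∀ i, x i ∈ K) (i j : Fin 4) :
    L α x i j ∈ K := by
  refine jmul_mem hα hx (fun l => ?_) i
  obtain rfl | h := eq_or_ne l j
  · simp [one_mem]
  · simp [h, zero_mem]

theorem minusAct_mem {α : ℂ} (hα : α ∈ K) {T : EndJ} (hT : ∀ i j, T i j ∈ K) (i j : Fin 4) :
    minusAct α T i j ∈ K :=
  sub_mem (hT i j) (mul_mem two_mem (L_mem hα (mulVec_mem hT unitJ_mem) i j))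

/-- Stability of the structure algebra is visible in coordinates; rationality holds since the
bracket uses only field operations on the entries, on `α` and on integers. -/
theorem bracket_mem_g {α : ℂ} (hα : α ∈ K) {X Y : Triple} (hX : X ∈ g K α)
    (hY : Y ∈ g K α) : bracket α X Y ∈ g K α := by
  refine Submodule.mem_inf.2 ⟨?_, ?_⟩
  · obtain ⟨u, a, d, x, rfl⟩ := exists_elt_of_mem_gC (Submodule.mem_inf.1 hX).1
    obtain ⟨u', a', d', x', rfl⟩ := exists_elt_of_mem_gC (Submodule.mem_inf.1 hY).1
    rw [bracket_elt]
    exact elt_mem_gC _ _ _ _ _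
  · obtain ⟨hX1, hX2, hX3⟩ := (Submodule.mem_inf.1 hX).2
    obtain ⟨hY1, hY2, hY3⟩ := (Submodule.mem_inf.1 hY).2
    refine ⟨fun i => ?_, fun i j => ?_, fun i => ?_⟩
    · exact sub_mem (mulVec_mem (minusAct_mem hα hX2) hY1 i)
        (signedApply_mem (minusAct_mem hα hY2) hX1 i)
    · exact add_mem (add_mem (superComm_mem hX2 hY2 i j)
        (mul_mem two_mem (add_mem (L_mem hα (jmul_mem hα hX3 hY1) i j)
          (superComm_mem (L_mem hα hX3) (L_mem hα hY1) i j))))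
        (mul_mem two_mem (add_mem (neg_mem (L_mem hα (jmul_mem hα hX1 hY3) i j))
          (superComm_mem (L_mem hα hX1) (L_mem hα hY3) i j)))
    · exact sub_mem (mulVec_mem hX2 hY3 i) (signedApply_mem hY2 hX3 i)

theorem dmat_mem {α : ℂ} (hα : α ∈ K) {d : Fin 5 → ℂ} (hd : ∀ i, d i ∈ K) (i j : Fin 4) :
    dmat α d i j ∈ K := by
  have h2 : (2 : ℂ) ∈ K := two_mem
  fin_cases i <;> fin_cases j <;> simp [dmat] <;>
    first
      | exact zero_mem K
      | exact hd _
      | exact mul_mem h2 (hd _)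
      | exact mul_mem (mul_mem h2 hα) (hd _)

theorem elt_mem_g {α : ℂ} (hα : α ∈ K) {u a x : J} {d : Fin 5 → ℂ} (hu : ∀ i, u i ∈ K)
    (ha : ∀ i, a i ∈ K) (hd : ∀ i, d i ∈ K) (hx : ∀ i, x i ∈ K) : elt α u a d x ∈ g K α :=
  Submodule.mem_inf.2 ⟨elt_mem_gC _ _ _ _ _, hu,
    fun i j => add_mem (L_mem hα ha i j) (dmat_mem hα hd i j), hx⟩

theorem elt_mem_k {α : ℂ} (hα : α ∈ K) {u : J} {d : Fin 5 → ℂ} (hu : ∀ i, u i ∈ K)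
    (hd : ∀ i, d i ∈ K) : elt α u 0 d (-u) ∈ k K α := by
  refine ⟨elt_mem_g hα hu (fun _ => zero_mem K) hd fun i => neg_mem (hu i), ?_, rfl⟩
  simpa [elt] using dmat_mem_der α d

theorem elt_mem_k₀ {α : ℂ} (hα : α ∈ K) {d : Fin 5 → ℂ} (hd : ∀ i, d i ∈ K) :
    elt α 0 0 d 0 ∈ k₀ K α := by
  refine ⟨?_, rfl⟩
  simpa using elt_mem_k (u := 0) hα (fun i => zero_mem K) hd

theorem exists_of_mem_k {α : ℂ} {X : Triple} (hX : X ∈ k K α) :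
    ∃ u d, X = elt α u 0 d (-u) := by
  obtain ⟨u, T, x⟩ := X
  obtain ⟨-, hT, hx⟩ := hX
  obtain ⟨d, hd⟩ := exists_dmat_of_mem_der hT
  exact ⟨u, d, by simp_all [elt]⟩

theorem exists_of_mem_k₀ {α : ℂ} {X : Triple} (hX : X ∈ k₀ K α) :
    ∃ d, X = elt α 0 0 d 0 := by
  obtain ⟨u, d, rfl⟩ := exists_of_mem_k hX.1
  obtain rfl : u = 0 := hX.2
  exact ⟨d, by simp⟩

end Rationality

section

open MvPolynomial (pderiv)
open Polynomial (derivative)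

/-! ## A polynomial model of the Fock space -/

namespace LamCase

/-- The number with `λ = α ν`. -/
def nu (α : ℂ) : LamCase → ℂ
  | alpha => 1
  | one => α⁻¹

/-- The number with `z₃ z₄ = -2 κ z₁ z₂` modulo `I_λ`. -/
def kap (α : ℂ) : LamCase → ℂ
  | alpha => 1
  | one => α

/-- The index `i` of the statement, counted from `0`. -/
def idx : LamCase → Fin 4
  | alpha => 0
  | one => 1

/-- The other even index. -/
def jdx : LamCase → Fin 4
  | alpha => 1
  | one => 0

/-- The sign of `∂_i` in `∂_1 - ∂_2`. -/
def eps : LamCase → ℂ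
  | alpha => 1
  | one => -1

theorem lam_eq {α : ℂ} (hα : α ≠ 0) (s : LamCase) : s.lam α = α * s.nu α := by
  cases s <;> simp [lam, nu, hα]

/-- The derivative in the direction of the other even coordinate. -/
def dj : (s : LamCase) → Derivation ℂ (MvPolynomial (Fin 2) ℂ) (MvPolynomial (Fin 2) ℂ)
  | alpha => pderiv 1
  | one => pderiv 0

/-- Restriction of polynomials to the line `z_j = 0`. -/
def res : (s : LamCase) → MvPolynomial (Fin 2) ℂ →ₐ[ℂ] Polynomial ℂ
  | alpha => MvPolynomial.aeval ![Polynomial.X, 0]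
  | one => MvPolynomial.aeval ![0, Polynomial.X]

end LamCase

/-- `(A, B, C, D)` stands for `A(z_i) + z_j B(z_i) + z₃ C(z_i) + z₄ D(z_i)`. -/
abbrev Model := Fin 4 → Polynomial ℂ

/-- Reduction modulo `I_λ`. -/
def red (α : ℂ) (s : LamCase) : SuperPoly →ₗ[ℂ] Model where
  toFun p := ![s.res p.a, s.res (s.dj p.a) - 2 * Polynomial.C (s.kap α) * Polynomial.X * s.res p.d,
    s.res p.b, s.res p.c]
  map_add' p q := by
    ext1 i; fin_cases i <;> simp [mul_add]; ring
  map_smul' t p := by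
    ext1 i; fin_cases i <;> simp [smul_sub]

theorem res_alpha_pderiv (f : MvPolynomial (Fin 2) ℂ) :
    LamCase.alpha.res (pderiv 0 f) = derivative (LamCase.alpha.res f) := by
  induction f using MvPolynomial.induction_on with
  | C c => simp [LamCase.res]
  | add f g hf hg => simp [hf, hg]
  | mul_X f i hf => fin_cases i <;> (simp [hf]; simp [LamCase.res]; try ring)

theorem res_one_pderiv (f : MvPolynomial (Fin 2) ℂ) :
    LamCase.one.res (pderiv 1 f) = derivative (LamCase.one.res f) := by
  induction f using MvPolynomial.induction_on with
  | C c => simp [LamCase.res]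
  | add f g hf hg => simp [hf, hg]
  | mul_X f i hf => fin_cases i <;> (simp [hf]; simp [LamCase.res]; try ring)

theorem res_C (s : LamCase) (c : ℂ) : s.res (MvPolynomial.C c) = Polynomial.C c := by
  cases s <;> simp [LamCase.res]

theorem res_alpha_X_zero : LamCase.alpha.res (MvPolynomial.X 0) = Polynomial.X := by
  simp [LamCase.res]

theorem res_alpha_X_one : LamCase.alpha.res (MvPolynomial.X 1) = 0 := by
  simp [LamCase.res]

theorem res_one_X_zero : LamCase.one.res (MvPolynomial.X 0) = 0 := by
  simp [LamCase.res]

theorem res_one_X_one : LamCase.one.res (MvPolynomial.X 1) = Polynomial.X := by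
  simp [LamCase.res]

section Operators

variable (α : ℂ) (s : LamCase)

open Polynomial (C X)

/-- The operator induced by `mU u`. -/
def sU (u : J) (q : Model) : Model :=
  ![C (u s.idx) * X * q 0,
    C (u s.idx) * X * q 1 + C (u s.jdx) * q 0
      + 2 * C (s.kap α) * X * (C (u 3) * q 2 - C (u 2) * q 3),
    C (u s.idx) * X * q 2 + C (u 2) * q 0,
    C (u s.idx) * X * q 3 + C (u 3) * q 0]

/-- The operator induced by `mT (2 • a) d`. -/
def sT (a : J) (d : Fin 5 → ℂ) (q : Model) : Model :=
  ![(C (s.lam α) * C (a 0) + C (s.nu α) * C (a 1)) * q 0 - 2 * C (a s.idx) * X * derivative (q 0)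
      + 2 * C (s.kap α) * X * (C (a 3) * q 2 - C (a 2) * q 3
        + C s.eps * (C (d 4) * q 2 - C (d 3) * q 3)),
    (C (s.lam α) * C (a 0) + C (s.nu α) * C (a 1)) * q 1
      - 2 * C (a s.idx) * X * derivative (q 1) - 2 * C (a s.jdx) * q 1
      + 2 * (C (a 2) - C s.eps * C (d 3))
        * (C (s.kap α) * X * derivative (q 3) - C (s.lam α) * q 3)
      - 2 * (C (a 3) - C s.eps * C (d 4))
        * (C (s.kap α) * X * derivative (q 2) - C (s.lam α) * q 2),
    (C (s.lam α) * C (a 0) + C (s.nu α) * C (a 1)) * q 2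
      - 2 * C (a s.idx) * X * derivative (q 2) - (C (a 0) + C (a 1)) * q 2
      - C (a 2) * (derivative (q 0) + q 1) + C (d 0) * q 2 + C (d 1) * q 3
      + C s.eps * C (d 3) * (derivative (q 0) - q 1),
    (C (s.lam α) * C (a 0) + C (s.nu α) * C (a 1)) * q 3
      - 2 * C (a s.idx) * X * derivative (q 3) - (C (a 0) + C (a 1)) * q 3
      - C (a 3) * (derivative (q 0) + q 1) - C (d 0) * q 3 + C (d 2) * q 2
      + C s.eps * C (d 4) * (derivative (q 0) - q 1)]

/-- The operator induced by `mX x`. -/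
def sX (x : J) (q : Model) : Model :=
  ![C (x s.idx) * (X * derivative (derivative (q 0)) - C (s.mu α) * derivative (q 0))
      - C (x s.jdx) * q 1
      + 2 * C (x 2) * (C (s.kap α) * X * derivative (q 3) - C (s.lam α) * q 3)
      - 2 * C (x 3) * (C (s.kap α) * X * derivative (q 2) - C (s.lam α) * q 2),
    C (x s.idx) * (X * derivative (derivative (q 1)) - C (s.mu α) * derivative (q 1)),
    C (x s.idx) * (X * derivative (derivative (q 2)) + (1 - C (s.mu α)) * derivative (q 2))
      + C (x 2) * derivative (q 1),
    C (x s.idx) * (X * derivative (derivative (q 3)) + (1 - C (s.mu α)) * derivative (q 3))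
      + C (x 3) * derivative (q 1)]

theorem red_mU (u : J) (p : SuperPoly) : red α s (mU u p) = sU α s u (red α s p) := by
  ext1 i
  cases s <;> fin_cases i <;>
    simp only [red, sU, mU_a, mU_b, mU_c, mU_d, LinearMap.coe_mk, AddHom.coe_mk] <;>
    simp [res_alpha_X_zero, res_alpha_X_one, res_one_X_zero, res_one_X_one, LamCase.idx,
      LamCase.jdx, LamCase.dj, LamCase.kap] <;> ring

variable {α}

theorem red_mT (hα : α ≠ 0) (a : J) (d : Fin 5 → ℂ) (p : SuperPoly) :
    red α s (mT α (s.nu α) ((2 : ℂ) • a) d p) = sT α s a d (red α s p) := by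
  have h : (MvPolynomial.C α : MvPolynomial (Fin 2) ℂ) * MvPolynomial.C α⁻¹ = 1 := by
    rw [← map_mul, mul_inv_cancel₀ hα, map_one]
  ext1 i
  cases s
  · fin_cases i <;>
    simp only [red, sT, mT_a, mT_b, mT_c, mT_d, eulerPart, LinearMap.coe_mk, AddHom.coe_mk] <;>
    simp [res_alpha_X_zero, res_alpha_X_one, LamCase.idx,
      LamCase.jdx, LamCase.dj, LamCase.kap, LamCase.nu, LamCase.eps, LamCase.lam,
      res_alpha_pderiv, pderiv_one_pderiv_zero, pderiv_two, map_ofNat] <;> ring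
  · fin_cases i <;>
    simp only [red, sT, mT_a, mT_b, mT_c, mT_d, eulerPart, LinearMap.coe_mk, AddHom.coe_mk,
      LamCase.nu, h] <;>
    simp [res_one_X_zero, res_one_X_one, LamCase.idx,
      LamCase.jdx, LamCase.dj, LamCase.kap, LamCase.eps, LamCase.lam,
      res_one_pderiv, ← pderiv_one_pderiv_zero, pderiv_two, map_ofNat] <;> ring

/-- The special value of `λ` enters here. On restriction to `z_j = 0`, the term `z_j ∂_j²`
disappears, and the rest of the Bessel operator in direction `j` sees `a` and `d` only through `∂_j
a - 2κ z_i d`, the second coordinate of `red`. The odd Bessel operators likewise yield its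
derivative. -/
theorem red_mX (hα : α ≠ 0) (x : J) (p : SuperPoly) :
    red α s (mX α (s.nu α) x p) = sX α s x (red α s p) := by
  have h : (MvPolynomial.C α : MvPolynomial (Fin 2) ℂ) * MvPolynomial.C α⁻¹ = 1 := by
    rw [← map_mul, mul_inv_cancel₀ hα, map_one]
  have h' : (C α : Polynomial ℂ) * C α⁻¹ = 1 := by
    rw [← map_mul, mul_inv_cancel₀ hα, map_one]
  ext1 i
  cases s
  · fin_cases i <;>
    simp only [red, sX, mX_a _ _ _ hα, mX_b _ _ _ hα, mX_c _ _ _ hα, mX_d _ _ _ hα,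
      LinearMap.coe_mk, AddHom.coe_mk] <;>
    simp [res_alpha_X_zero, res_alpha_X_one, LamCase.idx,
      LamCase.jdx, LamCase.dj, LamCase.kap, LamCase.nu, LamCase.mu, LamCase.lam,
      res_alpha_pderiv, pderiv_one_pderiv_zero, pderiv_two, map_ofNat,
      -mul_eq_mul_left_iff, -mul_eq_mul_right_iff] <;> ring
  · fin_cases i <;>
    simp only [red, sX, mX_a _ _ _ hα, mX_b _ _ _ hα, mX_c _ _ _ hα, mX_d _ _ _ hα,
      LinearMap.coe_mk, AddHom.coe_mk, LamCase.nu, h] <;>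
    simp [res_one_X_zero, res_one_X_one, LamCase.idx,
      LamCase.jdx, LamCase.dj, LamCase.kap, LamCase.mu, LamCase.lam,
      res_one_pderiv, ← pderiv_one_pderiv_zero, pderiv_two, map_ofNat,
      -mul_eq_mul_left_iff, -mul_eq_mul_right_iff] <;>
    first
      | ring1
      -- One component needs the constant polynomials `α` and `α⁻¹` to cancel, coming from `κμ = 1`.
      | linear_combination (-2 * C (x 1) * LamCase.one.res p.d) * h'

end Operators

end

/-! ### The ideal `I_λ` as the kernel of the reduction -/

section

open MvPolynomial (pderiv)
open Polynomial (derivative)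

/-- Extension of polynomials in `z_i` to polynomials in `z_1, z_2`. -/
def LamCase.ext : (s : LamCase) → Polynomial ℂ →ₐ[ℂ] MvPolynomial (Fin 2) ℂ
  | .alpha => Polynomial.aeval (MvPolynomial.X 0)
  | .one => Polynomial.aeval (MvPolynomial.X 1)

/-- The variable `z_i`. -/
def LamCase.xi : LamCase → MvPolynomial (Fin 2) ℂ
  | .alpha => MvPolynomial.X 0
  | .one => MvPolynomial.X 1

/-- The variable `z_j`. -/
def LamCase.xj : LamCase → MvPolynomial (Fin 2) ℂ
  | .alpha => MvPolynomial.X 1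
  | .one => MvPolynomial.X 0

section Kernel

variable (α : ℂ) (s : LamCase)

theorem ext_X : s.ext Polynomial.X = s.xi := by
  cases s <;> simp [LamCase.ext, LamCase.xi]

theorem res_xi : s.res s.xi = Polynomial.X := by
  cases s <;> simp [LamCase.res, LamCase.xi]

theorem res_xj : s.res s.xj = 0 := by
  cases s <;> simp [LamCase.res, LamCase.xj]

theorem dj_xi : s.dj s.xi = 0 := by
  cases s <;> simp [LamCase.dj, LamCase.xi]

theorem dj_xj : s.dj s.xj = 1 := by
  cases s <;> simp [LamCase.dj, LamCase.xj]

theorem res_ext (f : Polynomial ℂ) : s.res (s.ext f) = f := by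
  have : (s.res.comp s.ext) = AlgHom.id ℂ _ := by
    apply Polynomial.algHom_ext
    simp [ext_X, res_xi]
  exact congrArg (fun h => h f) this

theorem dj_ext (f : Polynomial ℂ) : s.dj (s.ext f) = 0 := by
  induction f using Polynomial.induction_on' with
  | add f g hf hg => simp [hf, hg]
  | monomial n c =>
    rw [← Polynomial.C_mul_X_pow_eq_monomial, ← Polynomial.smul_eq_C_mul, map_smul, map_pow,
      ext_X, Derivation.map_smul, Derivation.leibniz_pow, dj_xi]
    simp

/-- Division by `z_j`: a polynomial differs from its restriction to `z_j = 0` by a multiple of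
`z_j`. -/
theorem exists_eq_ext_res_add (f : MvPolynomial (Fin 2) ℂ) :
    ∃ g, f = s.ext (s.res f) + s.xj * g := by
  induction f using MvPolynomial.induction_on with
  | C c =>
    refine ⟨0, ?_⟩
    rw [res_C]
    cases s <;> simp [LamCase.ext]
  | add f g hf hg =>
    obtain ⟨f', hf⟩ := hf
    obtain ⟨g', hg⟩ := hg
    refine ⟨f' + g', ?_⟩
    rw [map_add, map_add]
    linear_combination hf + hg
  | mul_X f l hf =>
    obtain ⟨f', hf⟩ := hf
    have h : (MvPolynomial.X l : MvPolynomial (Fin 2) ℂ) = s.xi ∨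
        (MvPolynomial.X l : MvPolynomial (Fin 2) ℂ) = s.xj := by
      cases s <;> fin_cases l <;> simp [LamCase.xi, LamCase.xj]
    rcases h with h | h
    · refine ⟨f' * s.xi, ?_⟩
      rw [h, map_mul, map_mul, res_xi, ext_X]
      linear_combination s.xi * hf
    · refine ⟨f, ?_⟩
      rw [h, map_mul, res_xj]
      simp [mul_comm]

/-- The generators of the ideal `I_λ`. -/
def gens : Fin 4 → SuperPoly :=
  ![⟨2 * MvPolynomial.C (s.kap α) * s.xi * s.xj, 0, 0, 1⟩, ⟨s.xj ^ 2, 0, 0, 0⟩,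
    ⟨0, s.xj, 0, 0⟩, ⟨0, 0, s.xj, 0⟩]

theorem V_eq_span : V α s = Submodule.span ℂ (Set.range (gens α s)) := by
  cases s
  · have h : gens α .alpha =
        ![(2 : ℂ) • (z 0 * z 1) + z 2 * z 3, z 1 ^ 2, z 1 * z 2, z 1 * z 3] := by
      ext1 l
      fin_cases l <;> ext1 <;> simp [gens, LamCase.kap, LamCase.xi, LamCase.xj, z, pow_two,
        MvPolynomial.smul_eq_C_mul, map_ofNat, mul_assoc]
    rw [V, h]
    congr 1
    ext p
    simp [Matrix.range_cons, Matrix.range_empty]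
    tauto
  · have h : gens α .one =
        ![(2 * α) • (z 0 * z 1) + z 2 * z 3, z 0 ^ 2, z 0 * z 2, z 0 * z 3] := by
      ext1 l
      fin_cases l <;> ext1 <;> simp [gens, LamCase.kap, LamCase.xi, LamCase.xj, z, pow_two,
        MvPolynomial.smul_eq_C_mul, map_ofNat, mul_assoc]
      exact Or.inl (mul_comm _ _)
    rw [V, h]
    congr 1
    ext p
    simp [Matrix.range_cons, Matrix.range_empty]
    tauto

/-- The restrictions of `q.a`, `q.b`, `q.c` vanish, so in the second coordinate the product rule
leaves only `p.a` times the second coordinate of `q`. -/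
theorem red_mul_eq_zero {p q : SuperPoly} (hq : red α s q = 0) : red α s (p * q) = 0 := by
  have h : ∀ i, red α s q i = 0 := fun i => by rw [hq]; rfl
  have h0 := h 0
  have h1 := h 1
  have h2 := h 2
  have h3 := h 3
  simp [red] at h0 h1 h2 h3
  ext1 i
  fin_cases i <;> simp [red, h0, h2, h3]
  linear_combination s.res p.a * h1

/-- Divide every component by `z_j`, and `a` twice. The vanishing coordinates of `red` are what is
needed to solve for coefficients on the four generators. -/
theorem mem_idealI_of_red_eq_zero {p : SuperPoly} (hp : red α s p = 0) : p ∈ idealI α s := by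
  have h : ∀ i, red α s p i = 0 := fun i => by rw [hp]; rfl
  have h0 := h 0
  have h1 := h 1
  have h2 := h 2
  have h3 := h 3
  simp only [red, LinearMap.coe_mk, AddHom.coe_mk, Matrix.cons_val] at h0 h1 h2 h3
  obtain ⟨g, hg⟩ := exists_eq_ext_res_add s p.a
  rw [h0, map_zero, zero_add] at hg
  obtain ⟨b, hb⟩ := exists_eq_ext_res_add s p.b
  rw [h2, map_zero, zero_add] at hb
  obtain ⟨c, hc⟩ := exists_eq_ext_res_add s p.c
  rw [h3, map_zero, zero_add] at hc
  obtain ⟨d, hd⟩ := exists_eq_ext_res_add s p.d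
  obtain ⟨g', hg'⟩ := exists_eq_ext_res_add s g
  -- Because `a = z_j g`, the restriction of `∂_j a` is that of `g`, so the second coordinate links
  -- `a` to `d`.
  have hr : s.res g = 2 * Polynomial.C (s.kap α) * Polynomial.X * s.res p.d := by
    rw [hg, Derivation.leibniz, dj_xj] at h1
    simp only [smul_eq_mul, map_add, map_mul, res_xj, map_one] at h1
    linear_combination h1
  have hC : s.ext (Polynomial.C (s.kap α)) = MvPolynomial.C (s.kap α) := by
    cases s <;> simp [LamCase.ext]
  rw [hr, map_mul, map_mul, map_mul, map_ofNat, ext_X, hC] at hg'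
  rw [hg'] at hg
  have hv : ∀ l, gens α s l ∈ Ideal.span (V α s : Set SuperPoly) := by
    intro l
    rw [V_eq_span]
    exact Ideal.subset_span (Submodule.subset_span ⟨l, rfl⟩)
  -- The first coefficient supplies the `z_j`-free part of `d` together with the linear part of `a`;
  -- the `z₃`-term in the last one supplies the rest of `d`.
  have key : p = ⟨s.ext (s.res p.d), 0, 0, 0⟩ * gens α s 0 + ⟨g', 0, 0, 0⟩ * gens α s 1 + ⟨b, 0, 0, 0⟩ * gens α s 2
      + ⟨c, d, 0, 0⟩ * gens α s 3 := by
    ext1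
    · simp [gens]; linear_combination hg
    · simp [gens]; linear_combination hb
    · simp [gens]; linear_combination hc
    · simp [gens]; linear_combination hd
  change p ∈ Ideal.span (V α s : Set SuperPoly)
  rw [key]
  exact add_mem (add_mem (add_mem (Ideal.mul_mem_left _ _ (hv 0)) (Ideal.mul_mem_left _ _ (hv 1)))
    (Ideal.mul_mem_left _ _ (hv 2))) (Ideal.mul_mem_left _ _ (hv 3))

theorem red_mk (a b c d : MvPolynomial (Fin 2) ℂ) : red α s ⟨a, b, c, d⟩ =
    ![s.res a, s.res (s.dj a) - 2 * Polynomial.C (s.kap α) * Polynomial.X * s.res d,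
      s.res b, s.res c] := rfl

theorem red_gens (l : Fin 4) : red α s (gens α s l) = 0 := by
  have hz : (![0, 0, 0, 0] : Model) = 0 := by ext1 i; fin_cases i <;> rfl
  have h2 : s.dj (2 * MvPolynomial.C (s.kap α) * s.xi * s.xj) =
      2 * MvPolynomial.C (s.kap α) * s.xi := by
    have : (2 * MvPolynomial.C (s.kap α) * s.xi * s.xj : MvPolynomial (Fin 2) ℂ) =
        (2 * s.kap α) • (s.xi * s.xj) := by
      rw [MvPolynomial.smul_eq_C_mul, map_mul, map_ofNat, mul_assoc]
    rw [this, Derivation.map_smul, Derivation.leibniz, dj_xi, dj_xj,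
      MvPolynomial.smul_eq_C_mul, map_mul, map_ofNat]
    simp
  fin_cases l
  · change red α s ⟨_, _, _, _⟩ = 0
    rw [red_mk, h2, ← hz]
    simp only [map_mul, map_ofNat, res_xj, res_xi, res_C, mul_zero, map_zero, map_one, mul_one,
      sub_self]
  · change red α s ⟨_, _, _, _⟩ = 0
    rw [red_mk, ← hz, pow_two, Derivation.leibniz]
    simp only [map_mul, map_add, smul_eq_mul, res_xj, mul_zero, zero_mul, map_zero, sub_self,
      add_zero]
  · change red α s ⟨_, _, _, _⟩ = 0
    rw [red_mk, ← hz]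
    simp only [map_zero, res_xj, mul_zero, sub_self]
  · change red α s ⟨_, _, _, _⟩ = 0
    rw [red_mk, ← hz]
    simp only [map_zero, res_xj, mul_zero, sub_self]

theorem red_eq_zero_of_mem_V {p : SuperPoly} (hp : p ∈ V α s) : red α s p = 0 := by
  suffices V α s ≤ LinearMap.ker (red α s) from this hp
  rw [V_eq_span, Submodule.span_le]
  rintro _ ⟨l, rfl⟩
  exact red_gens α s l

theorem ker_red : LinearMap.ker (red α s) = idealI α s := by
  refine le_antisymm (fun p hp => mem_idealI_of_red_eq_zero α s hp) fun p hp => ?_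
  have hp' : p ∈ Ideal.span (V α s : Set SuperPoly) := hp
  clear hp
  rw [LinearMap.mem_ker]
  induction hp' using Submodule.span_induction with
  | mem p hp => exact red_eq_zero_of_mem_V α s hp
  | zero => exact map_zero _
  | add p q _ _ hp hq => rw [map_add, hp, hq, add_zero]
  | smul p q _ hq => exact red_mul_eq_zero α s hq

theorem red_surjective : Function.Surjective (red α s) := by
  intro q
  refine ⟨⟨s.ext (q 0) + s.xj * s.ext (q 1), s.ext (q 2), s.ext (q 3), 0⟩, ?_⟩
  ext1 i
  fin_cases i <;> simp [red, res_ext, res_xj, dj_ext, dj_xj]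

/-- The Fock space in terms of the polynomial model. -/
def ofModel : Model ≃ₗ[ℂ] Fock α s :=
  ((Submodule.quotEquivOfEq _ _ (ker_red α s).symm).trans
    ((red α s).quotKerEquivOfSurjective (red_surjective α s))).symm

theorem ofModel_red (p : SuperPoly) : ofModel α s (red α s p) = cls α s p := by
  rw [ofModel, LinearEquiv.symm_apply_eq]
  rfl

end Kernel

/-! ## The action on the model -/

section Action

variable {K : Subfield ℂ} {α : ℂ} {s : LamCase}

theorem red_rho (hα : α ≠ 0) (u a : J) (d : Fin 5 → ℂ) (x : J) (p : SuperPoly) :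
    red α s (rho α (s.lam α) (elt α u a d x) p) =
      (-2 * Complex.I) • sU α s ((1 / 4 : ℂ) • (u + x + Complex.I • a)) (red α s p)
        + sT α s ((Complex.I / 2) • (u - x)) d (red α s p)
        + (-(Complex.I / 2)) • sX α s (u + x - Complex.I • a) (red α s p) := by
  have h : Complex.I • (u - x) = (2 : ℂ) • (Complex.I / 2) • (u - x) := by
    rw [smul_smul, mul_div_cancel₀ _ (two_ne_zero' ℂ)]
  rw [rho, cayley_elt, LamCase.lam_eq hα, piRep_elt hα, h]
  simp only [LinearMap.add_apply, LinearMap.smul_apply, map_add, map_smul, red_mU,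
    red_mT s hα, red_mX s hα]

theorem sU_zero (q : Model) : sU α s 0 q = 0 := by
  ext1 i; fin_cases i <;> simp [sU]

theorem sX_zero (q : Model) : sX α s 0 q = 0 := by
  ext1 i; fin_cases i <;> simp [sX]

theorem sT_zero (q : Model) : sT α s 0 0 q = 0 := by
  ext1 i; fin_cases i <;> simp [sT]

theorem sU_smul (t : ℂ) (u : J) (q : Model) : sU α s (t • u) q = t • sU α s u q := by
  ext1 i; fin_cases i <;> simp [sU, Polynomial.smul_eq_C_mul] <;> ring

theorem sX_smul (t : ℂ) (u : J) (q : Model) : sX α s (t • u) q = t • sX α s u q := by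
  ext1 i; fin_cases i <;> simp [sX, Polynomial.smul_eq_C_mul] <;> ring

/-- On `𝔨` the multiplication and Bessel parts cancel, leaving a first-order operator that preserves
degree. -/
theorem red_rho_k (hα : α ≠ 0) (u : J) (d : Fin 5 → ℂ) (p : SuperPoly) :
    red α s (rho α (s.lam α) (elt α u 0 d (-u)) p) = sT α s (Complex.I • u) d (red α s p) := by
  have h : (Complex.I / 2) • (u - -u) = Complex.I • u := by module
  rw [red_rho hα, h]
  simp [sU_zero, sX_zero]

theorem rho_mem_idealI (hα : α ≠ 0) {X : Triple} (hX : X ∈ g K α) {p : SuperPoly}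
    (hp : p ∈ idealI α s) : rho α (s.lam α) X p ∈ idealI α s := by
  obtain ⟨u, a, d, x, rfl⟩ := exists_elt_of_mem_gC (Submodule.mem_inf.1 hX).1
  rw [← ker_red, LinearMap.mem_ker] at hp ⊢
  rw [red_rho hα, hp]
  ext1 i
  fin_cases i <;> simp [sU, sT, sX]

theorem exists_cls_eq (q : Model) : ∃ p, red α s p = q ∧ cls α s p = ofModel α s q := by
  obtain ⟨p, rfl⟩ := red_surjective α s q
  exact ⟨p, rfl, (ofModel_red α s p).symm⟩

/-- Stability is proved for all complex parameters, so rationality plays no role in this direction.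
-/
theorem isInvariant_k_of_forall (hα : α ≠ 0) {N : Submodule ℂ (Fock α s)}
    (h : ∀ (u : J) (d : Fin 5 → ℂ) (q : Model), ofModel α s q ∈ N →
      ofModel α s (sT α s (Complex.I • u) d q) ∈ N) : IsInvariant (k K α) N := by
  intro X hX p hp
  obtain ⟨u, d, rfl⟩ := exists_of_mem_k hX
  rw [← ofModel_red] at hp ⊢
  rw [red_rho_k hα]
  exact h u d _ hp

theorem isInvariant_k₀_of_forall (hα : α ≠ 0) {N : Submodule ℂ (Fock α s)}
    (h : ∀ (d : Fin 5 → ℂ) (q : Model), ofModel α s q ∈ N → ofModel α s (sT α s 0 d q) ∈ N) :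
    IsInvariant (k₀ K α) N := by
  intro X hX p hp
  obtain ⟨d, rfl⟩ := exists_of_mem_k₀ hX
  rw [← ofModel_red] at hp ⊢
  have := red_rho_k (s := s) hα 0 d p
  rw [neg_zero, smul_zero] at this
  rw [this]
  exact h d _ hp

theorem IsInvariant.mono {S T : Set Triple} (h : S ⊆ T) {N : Submodule ℂ (Fock α s)}
    (hN : IsInvariant T N) : IsInvariant S N :=
  fun X hX => hN X (h hX)

theorem IsInvariant.sT_mem (hαK : α ∈ K) (hα : α ≠ 0) {N : Submodule ℂ (Fock α s)}
    (hN : IsInvariant (k K α) N) {u : J} {d : Fin 5 → ℂ} (hu : ∀ i, u i ∈ K) (hd : ∀ i, d i ∈ K)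
    {q : Model} (hq : ofModel α s q ∈ N) : ofModel α s (sT α s (Complex.I • u) d q) ∈ N := by
  obtain ⟨p, rfl, hp⟩ := exists_cls_eq (α := α) (s := s) q
  rw [← red_rho_k hα, ofModel_red]
  exact hN _ (elt_mem_k hαK hu hd) p (hp ▸ hq)

theorem IsInvariant.sT_zero_mem (hαK : α ∈ K) (hα : α ≠ 0) {N : Submodule ℂ (Fock α s)}
    (hN : IsInvariant (k₀ K α) N) {d : Fin 5 → ℂ} (hd : ∀ i, d i ∈ K)
    {q : Model} (hq : ofModel α s q ∈ N) : ofModel α s (sT α s 0 d q) ∈ N := by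
  obtain ⟨p, rfl, hp⟩ := exists_cls_eq (α := α) (s := s) q
  have := red_rho_k (s := s) hα 0 d p
  rw [neg_zero, smul_zero] at this
  rw [← this, ofModel_red]
  exact hN _ (elt_mem_k₀ hαK hd) p (hp ▸ hq)

/-- The elements `(u/2, 0, u/2)` and `(0, L_u, 0)` of `𝔤` act by two independent combinations of
`sU` and `sX`. They are separated by complex coefficients, which is allowed because `N` is a complex
subspace even if `i ∉ K`. -/
theorem IsInvariant.sU_sX_mem (hαK : α ∈ K) (hα : α ≠ 0) {N : Submodule ℂ (Fock α s)}
    (hN : IsInvariant (g K α : Set Triple) N) {u : J} (hu : ∀ i, u i ∈ K) {q : Model}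
    (hq : ofModel α s q ∈ N) : ofModel α s (sU α s u q) ∈ N ∧ ofModel α s (sX α s u q) ∈ N := by
  obtain ⟨p, rfl, hp⟩ := exists_cls_eq (α := α) (s := s) q
  have h0 : ∀ i : Fin 4, (0 : J) i ∈ K := fun _ => zero_mem K
  have hu2 : ∀ i, ((1 / 2 : ℂ) • u) i ∈ K :=
    fun i => mul_mem (div_mem (one_mem K) two_mem) (hu i)
  have h1 := hN _ (elt_mem_g hαK (d := 0) hu2 h0 (fun _ => zero_mem K) hu2) p (hp ▸ hq)
  have h2 := hN _ (elt_mem_g hαK (d := 0) h0 hu (fun _ => zero_mem K) h0) p (hp ▸ hq)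
  rw [← ofModel_red, red_rho hα] at h1 h2
  have e1 : (1 / 4 : ℂ) • ((1 / 2 : ℂ) • u + (1 / 2 : ℂ) • u + Complex.I • (0 : J)) =
      (1 / 4 : ℂ) • u := by module
  have e2 : (1 / 2 : ℂ) • u + (1 / 2 : ℂ) • u - Complex.I • (0 : J) = u := by module
  have e3 : (1 / 4 : ℂ) • ((0 : J) + 0 + Complex.I • u) = (Complex.I / 4) • u := by module
  have e4 : (0 : J) + 0 - Complex.I • u = (-Complex.I) • u := by module
  rw [e1, e2, sub_self, smul_zero, sT_zero, add_zero] at h1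
  rw [e3, e4, sub_self, smul_zero, sT_zero, add_zero] at h2
  simp only [sU_smul, sX_smul, smul_smul, map_add, map_smul] at h1 h2
  have hI := Complex.I_sq
  constructor
  · have := N.smul_mem Complex.I (N.sub_mem h1 (N.smul_mem Complex.I h2))
    convert this using 1
    match_scalars <;> first
      | linear_combination (-(Complex.I ^ 2 - 2) / 2) * hI
      | linear_combination (Complex.I ^ 2 / 2) * hI
  · have := N.smul_mem Complex.I (N.add_mem h1 (N.smul_mem Complex.I h2))
    convert this using 1
    match_scalars <;> first
      | linear_combination (-(Complex.I ^ 2 - 2) / 2) * hI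
      | linear_combination (Complex.I ^ 2 / 2) * hI

end Action

end

section

open Polynomial (derivative)

/-! ## The homogeneous components -/

section Components

variable (α : ℂ) (s : LamCase)

open Polynomial (C X)

/-- The parametrization of `F_{λ,n+1}` by `ℂ⁴`. -/
def comp (n : ℕ) : (Fin 4 → ℂ) →ₗ[ℂ] Fock α s :=
  (ofModel α s).toLinearMap ∘ₗ
    { toFun := fun x => ![C (x 0) * X ^ (n + 1), C (x 1) * X ^ n, C (x 2) * X ^ n, C (x 3) * X ^ n]
      map_add' := fun x y => by ext1 i; fin_cases i <;> simp [add_mul]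
      map_smul' := fun t x => by
        ext1 i; fin_cases i <;> simp [Polynomial.smul_eq_C_mul, mul_assoc] }

theorem comp_apply (n : ℕ) (x : Fin 4 → ℂ) : comp α s n x = ofModel α s
    ![C (x 0) * X ^ (n + 1), C (x 1) * X ^ n, C (x 2) * X ^ n, C (x 3) * X ^ n] := rfl

theorem comp_injective (n : ℕ) : Function.Injective (comp α s n) := by
  rw [← LinearMap.ker_eq_bot, LinearMap.ker_eq_bot']
  intro x hx
  rw [comp_apply, LinearEquiv.map_eq_zero_iff] at hx
  ext1 i
  have h : ∀ i, _ = (0 : Model) i := fun i => congrFun hx i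
  have h0 := h 0
  have h1 := h 1
  have h2 := h 2
  have h3 := h 3
  simp at h0 h1 h2 h3
  fin_cases i <;> assumption

/-- The action of `mT (2 • a) d` on `F_{λ,n+1}`. -/
def act (n : ℕ) (a : J) (d : Fin 5 → ℂ) (x : Fin 4 → ℂ) : Fin 4 → ℂ :=
  ![(s.lam α * a 0 + s.nu α * a 1) * x 0 - 2 * a s.idx * (n + 1) * x 0
      + 2 * s.kap α * (a 3 * x 2 - a 2 * x 3 + s.eps * (d 4 * x 2 - d 3 * x 3)),
    (s.lam α * a 0 + s.nu α * a 1) * x 1 - 2 * a s.idx * n * x 1 - 2 * a s.jdx * x 1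
      + 2 * (a 2 - s.eps * d 3) * ((s.kap α * n - s.lam α) * x 3)
      - 2 * (a 3 - s.eps * d 4) * ((s.kap α * n - s.lam α) * x 2),
    (s.lam α * a 0 + s.nu α * a 1) * x 2 - 2 * a s.idx * n * x 2 - (a 0 + a 1) * x 2
      - a 2 * ((n + 1) * x 0 + x 1) + d 0 * x 2 + d 1 * x 3 + s.eps * d 3 * ((n + 1) * x 0 - x 1),
    (s.lam α * a 0 + s.nu α * a 1) * x 3 - 2 * a s.idx * n * x 3 - (a 0 + a 1) * x 3
      - a 3 * ((n + 1) * x 0 + x 1) - d 0 * x 3 + d 2 * x 2 + s.eps * d 4 * ((n + 1) * x 0 - x 1)]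

theorem X_mul_derivative_C_mul_X_pow (c : ℂ) (n : ℕ) :
    X * derivative (C c * X ^ n) = C (c * n) * X ^ n := by
  cases n with
  | zero => simp
  | succ n => rw [Polynomial.derivative_C_mul_X_pow]; simp; ring

theorem derivative_C_mul_X_pow_succ (c : ℂ) (n : ℕ) :
    derivative (C c * X ^ (n + 1)) = C (c * (n + 1)) * X ^ n := by
  rw [Polynomial.derivative_C_mul_X_pow]; simp

theorem sT_comp (n : ℕ) (a : J) (d : Fin 5 → ℂ) (x : Fin 4 → ℂ) :
    ofModel α s (sT α s a d
      ![C (x 0) * X ^ (n + 1), C (x 1) * X ^ n, C (x 2) * X ^ n, C (x 3) * X ^ n]) =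
    comp α s n (act α s n a d x) := by
  rw [comp_apply]
  congr 1
  ext1 i
  fin_cases i <;>
    simp only [sT, act, mul_assoc, X_mul_derivative_C_mul_X_pow, derivative_C_mul_X_pow_succ,
      Matrix.cons_val, Fin.zero_eta, Fin.mk_one, Fin.reduceFinMk] <;>
    simp only [map_add, map_sub, map_mul, map_ofNat, map_natCast, map_one, pow_succ] <;>
    ring

theorem zi_eq : s.zi = ⟨s.xi, 0, 0, 0⟩ := by cases s <;> rfl

theorem zj_eq : s.zj = ⟨s.xj, 0, 0, 0⟩ := by cases s <;> rfl

theorem mk_pow (f : MvPolynomial (Fin 2) ℂ) (n : ℕ) :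
    (⟨f, 0, 0, 0⟩ : SuperPoly) ^ n = ⟨f ^ n, 0, 0, 0⟩ := by
  induction n with
  | zero => ext1 <;> simp
  | succ m ih => rw [pow_succ, ih]; ext1 <;> simp [pow_succ]

theorem dj_xi_pow (n : ℕ) : s.dj (s.xi ^ n) = 0 := by
  rw [Derivation.leibniz_pow, dj_xi, smul_zero, smul_zero]

theorem cls_zi_mul (n : ℕ) : cls α s (s.zi * s.zi ^ n) = comp α s n (Pi.single 0 1) := by
  rw [← pow_succ', zi_eq, mk_pow, ← ofModel_red, red_mk, dj_xi_pow, comp_apply]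
  congr 1
  ext1 i
  fin_cases i <;> simp [res_xi]

theorem cls_zj_mul (n : ℕ) : cls α s (s.zj * s.zi ^ n) = comp α s n (Pi.single 1 1) := by
  have h : (⟨s.xj, 0, 0, 0⟩ * ⟨s.xi ^ n, 0, 0, 0⟩ : SuperPoly) = ⟨s.xj * s.xi ^ n, 0, 0, 0⟩ := by
    ext1 <;> simp
  rw [zi_eq, zj_eq, mk_pow, h, ← ofModel_red, red_mk, Derivation.leibniz, dj_xi_pow, dj_xj,
    comp_apply]
  congr 1
  ext1 i
  fin_cases i <;> simp [res_xi, res_xj]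

theorem cls_z_two_mul (n : ℕ) : cls α s (z 2 * s.zi ^ n) = comp α s n (Pi.single 2 1) := by
  have h : (z 2 * ⟨s.xi ^ n, 0, 0, 0⟩ : SuperPoly) = ⟨0, s.xi ^ n, 0, 0⟩ := by
    ext1 <;> simp [z]
  rw [zi_eq, mk_pow, h, ← ofModel_red, red_mk, comp_apply]
  congr 1
  ext1 i
  fin_cases i <;> simp [res_xi]

theorem cls_z_three_mul (n : ℕ) : cls α s (z 3 * s.zi ^ n) = comp α s n (Pi.single 3 1) := by
  have h : (z 3 * ⟨s.xi ^ n, 0, 0, 0⟩ : SuperPoly) = ⟨0, 0, s.xi ^ n, 0⟩ := by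
    ext1 <;> simp [z]
  rw [zi_eq, mk_pow, h, ← ofModel_red, red_mk, comp_apply]
  congr 1
  ext1 i
  fin_cases i <;> simp [res_xi]

theorem range_cls_z_mul (n : ℕ) : Set.range (fun l : Fin 4 => cls α s (z l * s.zi ^ n)) =
    Set.range fun l : Fin 4 => comp α s n (Pi.single l 1) := by
  have h0 := cls_zi_mul α s n
  have h1 := cls_zj_mul α s n
  have h2 := cls_z_two_mul α s n
  have h3 := cls_z_three_mul α s n
  cases s
  · congr 1
    funext l
    fin_cases l
    exacts [h0, h1, h2, h3]
  -- For `λ = 1` the distinguished variable is `z₂`, so the first two coordinates are interchanged.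
  · rw [← (Equiv.swap (0 : Fin 4) 1).surjective.range_comp fun l => comp α _ n (Pi.single l 1)]
    congr 1
    funext l
    fin_cases l
    exacts [h1, h0, h2, h3]

theorem Fk_succ (n : ℕ) : Fk α s (n + 1) = LinearMap.range (comp α s n) := by
  rw [Fk, range_cls_z_mul]
  refine le_antisymm (Submodule.span_le.2 ?_) ?_
  · rintro _ ⟨l, rfl⟩
    exact ⟨_, rfl⟩
  · rintro _ ⟨x, rfl⟩
    rw [← Finset.univ_sum_single x, map_sum]
    refine Submodule.sum_mem _ fun i _ => ?_
    have h : comp α s n (Pi.single i (x i)) = x i • comp α s n (Pi.single i 1) := by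
      rw [← map_smul, ← Pi.single_smul, smul_eq_mul, mul_one]
    rw [h]
    exact Submodule.smul_mem _ _ (Submodule.subset_span ⟨i, rfl⟩)

theorem Hk_succ (n : ℕ) : Hk α s (n + 1) =
    Submodule.span ℂ {comp α s n ![1, n - s.mu α, 0, 0], comp α s n ![0, 0, 1, 0],
      comp α s n ![0, 0, 0, 1]} := by
  have h1 : (![1, n - s.mu α, 0, 0] : Fin 4 → ℂ) =
      Pi.single 0 1 + (n - s.mu α) • Pi.single 1 1 := by
    ext i; fin_cases i <;> simp
  have h2 : (![0, 0, 1, 0] : Fin 4 → ℂ) = Pi.single 2 1 := by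
    ext i; fin_cases i <;> simp
  have h3 : (![0, 0, 0, 1] : Fin 4 → ℂ) = Pi.single 3 1 := by
    ext i; fin_cases i <;> simp
  rw [Hk, h1, h2, h3, map_add, map_smul]
  simp only [Nat.cast_add, Nat.cast_one, add_sub_cancel_right, Nat.add_sub_cancel, add_mul,
    smul_mul_assoc, map_add, map_smul]
  rw [cls_zi_mul, cls_zj_mul, cls_z_two_mul, cls_z_three_mul]

/-- Modulo `z_j²` only the first two terms of the binomial expansion survive. -/
theorem cls_add_pow (n : ℕ) :
    cls α s ((z 0 + z 1) ^ (n + 1)) = comp α s n ![1, n + 1, 0, 0] := by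
  have h : ∀ m : ℕ, (z 0 + z 1) ^ m = ⟨(s.xi + s.xj) ^ m, 0, 0, 0⟩ := by
    intro m
    induction m with
    | zero => ext1 <;> simp
    | succ m ih =>
      rw [pow_succ, ih]
      cases s <;> ext1 <;> simp [z, LamCase.xi, LamCase.xj, pow_succ, add_comm]
  rw [← ofModel_red, h, comp_apply, red_mk, Derivation.leibniz_pow, map_pow, map_add, res_xi,
    res_xj, map_add, dj_xi, dj_xj]
  congr 1
  ext1 i
  fin_cases i <;> simp [res_xi, res_xj]

theorem line_succ (n : ℕ) :
    line α s (n + 1) = Submodule.span ℂ {comp α s n ![1, n + 1, 0, 0]} := by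
  rw [line, cls_add_pow]

end Components

end

/-! ## Irreducibility over `𝔨₀` and `𝔨` -/

section Graded

variable {α : ℂ} {s : LamCase}

theorem isGraded_span {S : Set (Fock α s)}
    (h : ∀ v ∈ S, v ∈ evenPart.map (cls α s) ∨ v ∈ oddPart.map (cls α s)) :
    IsGraded (Submodule.span ℂ S) := by
  refine le_antisymm (Submodule.span_le.2 fun v hv => ?_) (sup_le inf_le_left inf_le_left)
  rcases h v hv with h | h
  · exact Submodule.mem_sup_left ⟨Submodule.subset_span hv, h⟩
  · exact Submodule.mem_sup_right ⟨Submodule.subset_span hv, h⟩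

theorem exists_even_or_odd (l : Fin 4) (n : ℕ) :
    cls α s (z l * s.zi ^ n) ∈ evenPart.map (cls α s) ∨
      cls α s (z l * s.zi ^ n) ∈ oddPart.map (cls α s) := by
  rw [zi_eq, mk_pow]
  fin_cases l
  · exact Or.inl ⟨_, by simp [evenPart, z], rfl⟩
  · exact Or.inl ⟨_, by simp [evenPart, z], rfl⟩
  · exact Or.inr ⟨_, by simp [oddPart, z], rfl⟩
  · exact Or.inr ⟨_, by simp [oddPart, z], rfl⟩

theorem isGraded_Fk (n : ℕ) : IsGraded (Fk α s n) := by
  cases n with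
  | zero =>
    refine isGraded_span fun v hv => Or.inl ?_
    rw [Set.mem_singleton_iff.1 hv]
    exact ⟨1, by simp [evenPart], rfl⟩
  | succ n =>
    refine isGraded_span ?_
    rintro _ ⟨l, rfl⟩
    exact exists_even_or_odd l n

theorem isGraded_Hk (n : ℕ) : IsGraded (Hk α s n) := by
  refine isGraded_span ?_
  rintro _ (rfl | rfl | rfl)
  · refine Or.inl ⟨_, ?_, rfl⟩
    rw [zi_eq, zj_eq, mk_pow]
    simp [evenPart]
  · exact exists_even_or_odd 2 _
  · exact exists_even_or_odd 3 _

theorem isGraded_line (n : ℕ) : IsGraded (line α s n) := by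
  refine isGraded_span fun v hv => Or.inl ?_
  rw [Set.mem_singleton_iff.1 hv]
  have h : (z 0 + z 1 : SuperPoly) = ⟨MvPolynomial.X 0 + MvPolynomial.X 1, 0, 0, 0⟩ := by
    ext1 <;> simp [z]
  exact ⟨_, by rw [h, mk_pow]; simp [evenPart], rfl⟩

theorem isGraded_top : IsGraded (⊤ : Submodule ℂ (Fock α s)) := by
  refine le_antisymm (fun v _ => ?_) le_top
  obtain ⟨p, rfl⟩ := Submodule.mkQ_surjective _ v
  have h : p = ⟨p.a, 0, 0, p.d⟩ + ⟨0, p.b, p.c, 0⟩ := by ext1 <;> simp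
  rw [h, map_add]
  exact Submodule.add_mem_sup ⟨trivial, _, by simp [evenPart], rfl⟩
    ⟨trivial, _, by simp [oddPart], rfl⟩

end Graded

/-! ### Relations between the constants, and coordinates on the two summands -/

section Parameters

variable {α : ℂ} {s : LamCase}

theorem kap_ne_zero (hα : α ≠ 0) : s.kap α ≠ 0 := by cases s <;> simp [LamCase.kap, hα]

theorem eps_ne_zero : s.eps ≠ 0 := by cases s <;> simp [LamCase.eps]

theorem lam_eq_kap_mul_mu (hα : α ≠ 0) : s.lam α = s.kap α * s.mu α := by
  cases s <;> simp [LamCase.lam, LamCase.kap, LamCase.mu, hα]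

theorem mu_eq_neg_one_iff : s.mu α = -1 ↔ α = -1 := by
  cases s
  · rfl
  · rw [LamCase.mu, inv_eq_iff_eq_inv, inv_neg, inv_one]

theorem mem_Hk_succ {n : ℕ} {v : Fock α s} : v ∈ Hk α s (n + 1) ↔
    ∃ x c d, v = comp α s n ![x, x * (n - s.mu α), c, d] := by
  have h : ∀ x c d : ℂ, x • comp α s n ![1, n - s.mu α, 0, 0] + c • comp α s n ![0, 0, 1, 0]
      + d • comp α s n ![0, 0, 0, 1] = comp α s n ![x, x * (n - s.mu α), c, d] := by
    intro x c d
    rw [← map_smul, ← map_smul, ← map_smul, ← map_add, ← map_add]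
    congr 1
    ext i; fin_cases i <;> simp
  rw [Hk_succ, Submodule.mem_span_triple]
  simp only [h, eq_comm]

theorem mem_line_succ {n : ℕ} {v : Fock α s} : v ∈ line α s (n + 1) ↔
    ∃ t : ℂ, v = comp α s n ![t, t * (n + 1), 0, 0] := by
  rw [line_succ, Submodule.mem_span_singleton]
  have h : ∀ t : ℂ, t • comp α s n ![1, n + 1, 0, 0] = comp α s n ![t, t * (n + 1), 0, 0] := by
    intro t
    rw [← map_smul]
    congr 1
    ext i; fin_cases i <;> simp
  simp only [h, eq_comm]

end Parameters

/-! ### Invariant subspaces of the components -/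

section Irreducible

variable {K : Subfield ℂ} {α : ℂ} {s : LamCase} {N : Submodule ℂ (Fock α s)} {n : ℕ}

theorem k₀_subset_k : k₀ K α ⊆ k K α := fun _ hX => hX.1

theorem IsInvariant.act_zero_mem (hN : IsInvariant (k₀ K α) N) (hαK : α ∈ K) (hα : α ≠ 0)
    {d : Fin 5 → ℂ} (hd : ∀ i, d i ∈ K) {x : Fin 4 → ℂ} (hx : comp α s n x ∈ N) :
    comp α s n (act α s n 0 d x) ∈ N := by
  rw [← sT_comp]
  exact hN.sT_zero_mem hαK hα hd hx

theorem IsInvariant.act_mem (hN : IsInvariant (k K α) N) (hαK : α ∈ K) (hα : α ≠ 0)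
    {u : J} (hu : ∀ i, u i ∈ K) {x : Fin 4 → ℂ} (hx : comp α s n x ∈ N) :
    comp α s n (act α s n (Complex.I • u) 0 x) ∈ N := by
  rw [← sT_comp]
  exact hN.sT_mem hαK hα hu (fun _ => zero_mem K) hx

theorem single_mem (l : Fin 5) (i : Fin 5) : (Pi.single l 1 : Fin 5 → ℂ) i ∈ K := by
  obtain rfl | h := eq_or_ne i l
  · simp [one_mem]
  · simp [h, zero_mem]

theorem mem_of_smul_mem {M : Type*} [AddCommGroup M] [Module ℂ M] {P : Submodule ℂ M} {t : ℂ}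
    (ht : t ≠ 0) {v : M} (h : t • v ∈ P) : v ∈ P :=
  (Submodule.smul_mem_iff P ht).1 h

theorem comp_mem_of_eq_smul {t : ℂ} (ht : t ≠ 0) {x y : Fin 4 → ℂ} (hx : comp α s n x ∈ N)
    (h : x = t • y) : comp α s n y ∈ N := by
  rw [h, map_smul] at hx
  exact mem_of_smul_mem ht hx

/-- An invariant subspace containing a vector with nonzero odd part contains all odd vectors. -/
theorem IsInvariant.odd_mem (hN : IsInvariant (k₀ K α) N) (hαK : α ∈ K) (hα : α ≠ 0)
    {x : Fin 4 → ℂ} (hx : comp α s n x ∈ N) (h : x 2 ≠ 0 ∨ x 3 ≠ 0) (c d : ℂ) :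
    comp α s n ![0, 0, c, d] ∈ N := by
  -- `E` and `F` are the nilpotent elements of `sl₂`; they kill even vectors and exchange the two
  -- odd coordinates.
  have E : ∀ y, comp α s n y ∈ N → comp α s n ![0, 0, y 3, 0] ∈ N := by
    intro y hy
    convert hN.act_zero_mem hαK hα (single_mem 1) hy using 2
    ext i; fin_cases i <;> simp [act]
  have F : ∀ y, comp α s n y ∈ N → comp α s n ![0, 0, 0, y 2] ∈ N := by
    intro y hy
    convert hN.act_zero_mem hαK hα (single_mem 2) hy using 2
    ext i; fin_cases i <;> simp [act]
  have h2 : comp α s n ![0, 0, 1, 0] ∈ N := by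
    rcases h with h | h
    · exact comp_mem_of_eq_smul h (E _ (F _ hx)) (by ext i; fin_cases i <;> simp)
    · exact comp_mem_of_eq_smul h (E _ hx) (by ext i; fin_cases i <;> simp)
  have h3 := F _ h2
  convert N.add_mem (N.smul_mem c h2) (N.smul_mem d h3) using 1
  rw [← map_smul, ← map_smul, ← map_add]
  congr 1
  ext i; fin_cases i <;> simp

/-- The even vector of `H_{λ,n+1}` lies in every invariant subspace containing an odd vector. -/
theorem IsInvariant.even_mem (hN : IsInvariant (k₀ K α) N) (hαK : α ∈ K) (hα : α ≠ 0)
    (h : comp α s n ![0, 0, 0, 1] ∈ N) : comp α s n ![1, n - s.mu α, 0, 0] ∈ N := by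
  refine comp_mem_of_eq_smul (t := -2 * s.kap α * s.eps) ?_
    (hN.act_zero_mem hαK hα (single_mem 3) h) ?_
  · exact mul_ne_zero (mul_ne_zero (by norm_num) (kap_ne_zero hα)) eps_ne_zero
  · ext i
    fin_cases i <;> simp [act, lam_eq_kap_mul_mu hα]
    all_goals ring

/-- The odd derivation `e₁ ↦ ξ` on even vectors. -/
theorem IsInvariant.odd_of_even_mem (hN : IsInvariant (k₀ K α) N) (hαK : α ∈ K) (hα : α ≠ 0)
    {a b : ℂ} (h : comp α s n ![a, b, 0, 0] ∈ N) (hab : (n + 1) * a ≠ b) (c d : ℂ) :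
    comp α s n ![0, 0, c, d] ∈ N := by
  refine hN.odd_mem hαK hα (hN.act_zero_mem hαK hα (single_mem 3) h) (Or.inl ?_) c d
  simp [act, eps_ne_zero, sub_ne_zero, hab]

theorem isInvariant_Hk (hα : α ≠ 0) (n : ℕ) : IsInvariant (k₀ K α) (Hk α s (n + 1)) := by
  refine isInvariant_k₀_of_forall hα fun d q hq => ?_
  obtain ⟨x, c, e, h⟩ := mem_Hk_succ.1 hq
  rw [comp_apply, (ofModel α s).injective.eq_iff] at h
  rw [h, sT_comp, mem_Hk_succ]
  refine ⟨act α s n 0 d ![x, x * (n - s.mu α), c, e] 0, act α s n 0 d ![x, x * (n - s.mu α), c, e] 2,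
    act α s n 0 d ![x, x * (n - s.mu α), c, e] 3, ?_⟩
  congr 1
  ext i
  fin_cases i <;> simp [act, lam_eq_kap_mul_mu hα]
  ring

theorem isInvariant_line (hα : α ≠ 0) (n : ℕ) : IsInvariant (k₀ K α) (line α s (n + 1)) := by
  refine isInvariant_k₀_of_forall hα fun d q hq => ?_
  obtain ⟨t, h⟩ := mem_line_succ.1 hq
  rw [comp_apply, (ofModel α s).injective.eq_iff] at h
  rw [h, sT_comp, mem_line_succ]
  -- Derivations kill the line: the even coordinates only see odd input, and the odd ones see only
  -- `(n + 1) x₀ - x₁`.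
  refine ⟨0, ?_⟩
  congr 1
  ext i
  fin_cases i <;> simp [act] <;> ring_nf <;> simp

theorem isInvariant_Fk (hα : α ≠ 0) (n : ℕ) : IsInvariant (k K α) (Fk α s (n + 1)) := by
  refine isInvariant_k_of_forall hα fun u d q hq => ?_
  rw [Fk_succ] at hq ⊢
  obtain ⟨x, h⟩ := hq
  rw [comp_apply, (ofModel α s).injective.eq_iff] at h
  rw [← h, sT_comp]
  exact ⟨_, rfl⟩

/-- A nonzero even vector of `H` is off the line `(1, n + 1)` when `α ≠ -1`, so the odd derivation
moves it to a nonzero odd vector. Hence any nonzero invariant subspace contains all odd vectors and,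
from them, the even generator. -/
theorem isIrred_Hk (hαK : α ∈ K) (hα : α ≠ 0) (h1 : α ≠ -1) (n : ℕ) :
    IsIrred (k₀ K α) (Hk α s (n + 1)) := by
  refine ⟨⟨isGraded_Hk _, isInvariant_Hk hα n⟩, ?_, fun N hNle hN => ?_⟩
  · refine (Submodule.ne_bot_iff _).2 ⟨_, mem_Hk_succ.2 ⟨0, 1, 0, rfl⟩, fun h => ?_⟩
    have := congrFun ((map_eq_zero_iff _ (comp_injective α s n)).1 h) 2
    simp at this
  · refine or_iff_not_imp_left.2 fun hbot => le_antisymm hNle ?_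
    obtain ⟨v, hv, hv0⟩ := (Submodule.ne_bot_iff _).1 hbot
    obtain ⟨x, c, d, rfl⟩ := mem_Hk_succ.1 (hNle hv)
    have hodd : ∀ c d : ℂ, comp α s n ![0, 0, c, d] ∈ N := by
      by_cases hcd : c ≠ 0 ∨ d ≠ 0
      · exact hN.odd_mem hαK hα hv hcd
      · push Not at hcd
        obtain ⟨rfl, rfl⟩ := hcd
        refine hN.odd_of_even_mem hαK hα hv fun h => h1 ?_
        have hx : x ≠ 0 := by
          rintro rfl
          apply hv0
          rw [map_eq_zero_iff _ (comp_injective α s n)]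
          ext i; fin_cases i <;> simp
        rw [← mu_eq_neg_one_iff (s := s)]
        refine mul_left_cancel₀ hx ?_
        linear_combination h
    have heven := hN.even_mem hαK hα (hodd 0 1)
    rw [Hk_succ, Submodule.span_le]
    rintro _ (rfl | rfl | rfl)
    exacts [heven, hodd 1 0, hodd 0 1]

theorem eq_bot_or_eq_of_le_span_singleton {M : Type*} [AddCommGroup M] [Module ℂ M] {v : M}
    (hv : v ≠ 0) {P : Submodule ℂ M} (h : P ≤ Submodule.span ℂ {v}) :
    P = ⊥ ∨ P = Submodule.span ℂ {v} :=
  (nonzero_span_atom v hv).le_iff.1 h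

theorem comp_line_ne_zero (n : ℕ) : comp α s n ![1, n + 1, 0, 0] ≠ 0 := fun h => by
  simpa using congrFun ((map_eq_zero_iff _ (comp_injective α s n)).1 h) 0

theorem isIrred_line (hα : α ≠ 0) (n : ℕ) : IsIrred (k₀ K α) (line α s (n + 1)) := by
  refine ⟨⟨isGraded_line _, isInvariant_line hα n⟩, ?_, fun N hNle _ => ?_⟩
  · rw [line_succ, Ne, Submodule.span_singleton_eq_bot]
    exact comp_line_ne_zero n
  · rw [line_succ] at hNle ⊢
    exact eq_bot_or_eq_of_le_span_singleton (comp_line_ne_zero n) hNle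

theorem Hk_inf_line (h1 : α ≠ -1) (n : ℕ) : Hk α s (n + 1) ⊓ line α s (n + 1) = ⊥ := by
  rw [Submodule.eq_bot_iff]
  rintro v ⟨hH, hL⟩
  obtain ⟨x, c, d, rfl⟩ := mem_Hk_succ.1 hH
  obtain ⟨t, h⟩ := mem_line_succ.1 hL
  have h' := comp_injective α s n h
  have e0 : x = t := congrFun h' 0
  have e1 : x * (n - s.mu α) = t * (n + 1) := congrFun h' 1
  subst e0
  have hx : x = 0 := by
    by_contra hx
    refine h1 ((mu_eq_neg_one_iff (s := s)).1 (mul_left_cancel₀ hx ?_))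
    linear_combination -e1
  rw [h, hx, map_eq_zero_iff _ (comp_injective α s n)]
  ext i; fin_cases i <;> simp

theorem Hk_le_Fk (n : ℕ) : Hk α s (n + 1) ≤ Fk α s (n + 1) := by
  intro v hv
  obtain ⟨x, c, d, rfl⟩ := mem_Hk_succ.1 hv
  exact Fk_succ α s n ▸ ⟨_, rfl⟩

theorem line_le_Fk (n : ℕ) : line α s (n + 1) ≤ Fk α s (n + 1) := by
  intro v hv
  obtain ⟨t, rfl⟩ := mem_line_succ.1 hv
  exact Fk_succ α s n ▸ ⟨_, rfl⟩

theorem Hk_sup_line (h1 : α ≠ -1) (n : ℕ) :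
    Hk α s (n + 1) ⊔ line α s (n + 1) = Fk α s (n + 1) := by
  refine le_antisymm (sup_le (Hk_le_Fk n) (line_le_Fk n)) fun v hv => ?_
  rw [Fk_succ] at hv
  obtain ⟨x, rfl⟩ := hv
  have hμ : 1 + s.mu α ≠ 0 := fun h =>
    h1 ((mu_eq_neg_one_iff (s := s)).1 (by linear_combination h))
  -- Solves `(x₀, x₁) = (x₀ - t)(1, n - μ) + t(1, n + 1)`, whose determinant is `1 + μ`.
  let t := (x 1 - (n - s.mu α) * x 0) / (1 + s.mu α)
  have ht : t * (1 + s.mu α) = x 1 - (n - s.mu α) * x 0 := div_mul_cancel₀ _ hμ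
  refine Submodule.mem_sup.2 ⟨_, mem_Hk_succ.2 ⟨x 0 - t, x 2, x 3, rfl⟩, _,
    mem_line_succ.2 ⟨t, rfl⟩, ?_⟩
  rw [← map_add]
  congr 1
  ext i
  fin_cases i <;> simp
  linear_combination ht

theorem red_one : red α s 1 = ![1, 0, 0, 0] := by
  change red α s ⟨1, 0, 0, 0⟩ = _
  rw [red_mk, Derivation.map_one_eq_zero]
  simp

theorem Fk_zero_ne : cls α s 1 ≠ 0 := by
  rw [← ofModel_red, (ofModel α s).map_ne_zero_iff, red_one]
  intro h
  simpa using congrFun h 0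

theorem isIrred_Fk_zero (hα : α ≠ 0) : IsIrred (k K α) (Fk α s 0) := by
  refine ⟨⟨isGraded_Fk 0, ?_⟩, ?_, fun N hNle _ => ?_⟩
  · refine isInvariant_k_of_forall hα fun u d q hq => ?_
    obtain ⟨t, h⟩ := Submodule.mem_span_singleton.1 hq
    rw [← ofModel_red, ← map_smul, (ofModel α s).injective.eq_iff] at h
    refine Submodule.mem_span_singleton.2
      ⟨t * (s.lam α * (Complex.I * u 0) + s.nu α * (Complex.I * u 1)), ?_⟩
    rw [← ofModel_red, ← map_smul, ← h, red_one]
    congr 1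
    ext1 i
    fin_cases i <;>
      simp only [sT, Pi.smul_apply, smul_zero, Polynomial.smul_eq_C_mul, Matrix.cons_val,
        Fin.zero_eta, Fin.mk_one, Fin.reduceFinMk, mul_one, mul_zero, Polynomial.derivative_C,
        map_zero, add_zero, sub_zero, smul_eq_mul]
    simp [mul_comm]
  · rw [Fk, Ne, Submodule.span_singleton_eq_bot]
    exact Fk_zero_ne
  · exact eq_bot_or_eq_of_le_span_singleton Fk_zero_ne hNle

theorem single_J_mem (l : Fin 4) (i : Fin 4) : (Pi.single l 1 : J) i ∈ K := by
  obtain rfl | h := eq_or_ne i l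
  · simp [one_mem]
  · simp [h, zero_mem]

/-- Beyond `𝔨₀`, the operator of `L_ξ` moves the line `(1, n + 1)` to odd vectors and yields a
second even vector from an odd one. -/
theorem isIrred_Fk_succ (hαK : α ∈ K) (hα : α ≠ 0) (hμ : ∀ n : ℕ, s.mu α ≠ n) (n : ℕ) :
    IsIrred (k K α) (Fk α s (n + 1)) := by
  refine ⟨⟨isGraded_Fk _, isInvariant_Fk hα n⟩, ?_, fun N hNle hN => ?_⟩
  · exact fun h => comp_line_ne_zero (α := α) (s := s) n
      ((Submodule.eq_bot_iff _).1 h _ (Fk_succ α s n ▸ ⟨_, rfl⟩))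
  · refine or_iff_not_imp_left.2 fun hbot => le_antisymm hNle ?_
    obtain ⟨v, hv, hv0⟩ := (Submodule.ne_bot_iff _).1 hbot
    have hN₀ : IsInvariant (k₀ K α) N := hN.mono k₀_subset_k
    rw [Fk_succ] at hNle ⊢
    obtain ⟨x, rfl⟩ := hNle hv
    have hI := Complex.I_ne_zero
    have hodd : ∀ c d : ℂ, comp α s n ![0, 0, c, d] ∈ N := by
      by_cases hcd : x 2 ≠ 0 ∨ x 3 ≠ 0
      · exact hN₀.odd_mem hαK hα hv hcd
      · push Not at hcd
        have hx : x = ![x 0, x 1, 0, 0] := by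
          ext i; fin_cases i <;> simp [hcd]
        rw [hx] at hv
        by_cases h : (n + 1) * x 0 = x 1
        -- On this line the odd derivations vanish, while `L_ξ` sees `(n + 1) x₀ + x₁ = 2(n + 1)
        -- x₀`.
        · refine hN₀.odd_mem hαK hα (hN.act_mem hαK hα (single_J_mem 2) hv) (Or.inl ?_)
          intro h'
          simp [act] at h'
          have h0 : (n + 1 : ℂ) * x 0 = 0 := by linear_combination (h' + h) / 2
          have hx0 : x 0 = 0 := (mul_eq_zero.1 h0).resolve_left (Nat.cast_add_one_ne_zero n)
          apply hv0
          rw [hx, ← h, hx0, map_eq_zero_iff _ (comp_injective α s n)]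
          ext i; fin_cases i <;> simp
        · exact hN₀.odd_of_even_mem hαK hα hv h
    have he := hN₀.even_mem hαK hα (hodd 0 1)
    have he' : comp α s n ![1, -(n - s.mu α), 0, 0] ∈ N := by
      refine comp_mem_of_eq_smul (t := -2 * s.kap α * Complex.I) ?_
        (hN.act_mem hαK hα (single_J_mem 2) (hodd 0 1)) ?_
      · exact mul_ne_zero (mul_ne_zero (by norm_num) (kap_ne_zero hα)) hI
      · have hi : (Pi.single 2 1 : J) s.idx = 0 := by cases s <;> simp [LamCase.idx]
        have hj : (Pi.single 2 1 : J) s.jdx = 0 := by cases s <;> simp [LamCase.jdx]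
        ext i
        fin_cases i <;> simp [act, lam_eq_kap_mul_mu hα, hi, hj]
        all_goals ring
    -- This makes `(1, n - μ)` and `(1, -(n - μ))` a basis of the even part.
    have hμn : (n : ℂ) - s.mu α ≠ 0 := sub_ne_zero.2 (hμ n).symm
    rintro _ ⟨y, rfl⟩
    have := N.add_mem (N.add_mem (N.smul_mem ((y 0 + y 1 / (n - s.mu α)) / 2) he)
      (N.smul_mem ((y 0 - y 1 / (n - s.mu α)) / 2) he')) (hodd (y 2) (y 3))
    rw [← map_smul, ← map_smul, ← map_add, ← map_add] at this
    convert this using 2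
    ext i
    fin_cases i <;> simp <;> field_simp <;> ring

/-- For `α = -1` the even vector generated by odd ones is `(z₁ + z₂)^{n+1}` itself. The summand
containing a vector with nonzero odd part therefore contains all odd vectors and this line, leaving
no room for a complement. -/
theorem isIndecomp_Fk (hαK : α ∈ K) (hα : α ≠ 0) (h1 : α = -1) (n : ℕ) :
    IsIndecomp (k₀ K α) (Fk α s (n + 1)) := by
  refine ⟨⟨isGraded_Fk _, (isInvariant_Fk hα n).mono k₀_subset_k⟩, ?_, ?_⟩
  · exact fun h => comp_line_ne_zero (α := α) (s := s) n
      ((Submodule.eq_bot_iff _).1 h _ (Fk_succ α s n ▸ ⟨_, rfl⟩))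
  have hμ : s.mu α = -1 := mu_eq_neg_one_iff.2 h1
  have key : ∀ N N' : Submodule ℂ (Fock α s), IsInvariant (k₀ K α) N → IsInvariant (k₀ K α) N' →
      N ⊓ N' = ⊥ → N' ≤ Fk α s (n + 1) → ∀ x, comp α s n x ∈ N → (x 2 ≠ 0 ∨ x 3 ≠ 0) →
      N' = ⊥ := by
    intro N N' hN hN' hinf hle x hx hx0
    have hodd := hN.odd_mem hαK hα hx hx0
    have heven := hN.even_mem hαK hα (hodd 0 1)
    have hdisj : ∀ v ∈ N, v ∈ N' → v = 0 := fun v h h' =>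
      (Submodule.eq_bot_iff _).1 hinf v ⟨h, h'⟩
    have hno : comp α s n ![0, 0, 1, 0] ∉ N' := fun h => by
      have := hdisj _ (hodd 1 0) h
      simpa using congrFun ((map_eq_zero_iff _ (comp_injective α s n)).1 this) 2
    rw [Submodule.eq_bot_iff]
    intro v hv
    rw [Fk_succ] at hle
    obtain ⟨y, rfl⟩ := hle hv
    by_cases hy : y 2 ≠ 0 ∨ y 3 ≠ 0
    · exact absurd (hN'.odd_mem hαK hα hv hy 1 0) hno
    push Not at hy
    have hy' : y = ![y 0, y 1, 0, 0] := by
      ext i; fin_cases i <;> simp [hy]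
    by_cases h : (n + 1) * y 0 = y 1
    -- An even vector on the line is a multiple of `heven`, because `n - μ = n + 1`.
    · refine hdisj _ ?_ hv
      convert N.smul_mem (y 0) heven using 1
      rw [← map_smul]
      congr 1
      rw [hy', hμ, ← h]
      ext i; fin_cases i <;> simp [mul_comm]
    · rw [hy'] at hv
      exact absurd (hN'.odd_of_even_mem hαK hα hv h 1 0) hno
  intro N₁ N₂ hN₁ hN₂ hinf hsup
  have hle₁ : N₁ ≤ Fk α s (n + 1) := hsup ▸ le_sup_left
  have hle₂ : N₂ ≤ Fk α s (n + 1) := hsup ▸ le_sup_right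
  -- Since `z₃ z_i^n` is in the sum, one summand has a vector with nonzero `z₃`-coordinate.
  have hmem : comp α s n ![0, 0, 1, 0] ∈ N₁ ⊔ N₂ := hsup ▸ Fk_succ α s n ▸ ⟨_, rfl⟩
  obtain ⟨v, hv, w, hw, hvw⟩ := Submodule.mem_sup.1 hmem
  have hv' := hle₁ hv
  have hw' := hle₂ hw
  rw [Fk_succ] at hv' hw'
  obtain ⟨x, rfl⟩ := hv'
  obtain ⟨y, rfl⟩ := hw'
  rw [← map_add] at hvw
  have h2 : x 2 + y 2 = 1 := congrFun (comp_injective α s n hvw) 2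
  by_cases hx : x 2 = 0
  · refine Or.inl (key N₂ N₁ hN₂ hN₁ (inf_comm N₁ N₂ ▸ hinf) hle₁ y hw (Or.inl ?_))
    rw [hx, zero_add] at h2
    simp [h2]
  · exact Or.inr (key N₁ N₂ hN₁ hN₂ hinf hle₂ x hv (Or.inl hx))

theorem exists_submod_Fk (hα : α ≠ 0) (n : ℕ) :
    ∃ N : Submodule ℂ (Fock α s), IsSubmod (k₀ K α) N ∧ ⊥ < N ∧ N < Fk α s (n + 1) := by
  refine ⟨line α s (n + 1), ⟨isGraded_line _, isInvariant_line hα n⟩, ?_,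
    lt_of_le_of_ne (line_le_Fk n) fun h => ?_⟩
  · rw [bot_lt_iff_ne_bot]
    exact (isIrred_line (K := K) hα n).2.1
  · have hm : comp α s n ![0, 0, 1, 0] ∈ line α s (n + 1) := h ▸ Fk_succ α s n ▸ ⟨_, rfl⟩
    obtain ⟨t, ht⟩ := mem_line_succ.1 hm
    simpa using congrFun (comp_injective α s n ht) 2

end Irreducible

section

open Polynomial (derivative)

/-! ## Irreducibility over `𝔤` and the `𝔨`-type decomposition -/

section Lowering

open Polynomial (C X)

variable {α : ℂ} {s : LamCase}

theorem coeff_X_mul_derivative (f : Polynomial ℂ) (m : ℕ) :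
    (X * derivative f).coeff m = f.coeff m * m := by
  cases m with
  | zero => simp
  | succ m => simp [Polynomial.coeff_X_mul, Polynomial.coeff_derivative]

/-- The vectors of degree at most `n`. -/
def DegreeLE (n : ℕ) (q : Model) : Prop :=
  ∀ m, (n < m → (q 0).coeff m = 0) ∧
    (n ≤ m → (q 1).coeff m = 0 ∧ (q 2).coeff m = 0 ∧ (q 3).coeff m = 0)

theorem exists_degreeLE (q : Model) : ∃ n, DegreeLE n q := by
  refine ⟨(q 0).natDegree + (q 1).natDegree + (q 2).natDegree + (q 3).natDegree + 1,
    fun m => ⟨fun h => ?_, fun h => ⟨?_, ?_, ?_⟩⟩⟩ <;>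
  exact Polynomial.coeff_eq_zero_of_natDegree_lt (by omega)

/-- The bound is strict for the last three coordinates because `z_j`, `z₃`, `z₄` each carry degree
one; with this shift every Bessel operator lowers the total degree. -/
theorem DegreeLE.sX {n : ℕ} {q : Model} (h : DegreeLE (n + 1) q) (x : J) :
    DegreeLE n (sX α s x q) := by
  refine fun m => ⟨fun hm => ?_, fun hm => ⟨?_, ?_, ?_⟩⟩
  · have h0 := (h (m + 1)).1 (by omega)
    have h1 := (h m).2 hm
    simp [FockD.sX, coeff_X_mul_derivative, Polynomial.coeff_derivative, Polynomial.coeff_C_mul,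
      h0, h1, mul_assoc, ← map_ofNat (C : ℂ →+* Polynomial ℂ)]
  all_goals
    have h1 := (h (m + 1)).2 (by omega)
    simp [FockD.sX, coeff_X_mul_derivative, Polynomial.coeff_derivative, Polynomial.coeff_C_mul,
      h1, sub_mul]

theorem sX_single_idx (q : Model) : sX α s (Pi.single s.idx 1) q =
    ![X * derivative (derivative (q 0)) - C (s.mu α) * derivative (q 0),
      X * derivative (derivative (q 1)) - C (s.mu α) * derivative (q 1),
      X * derivative (derivative (q 2)) + (1 - C (s.mu α)) * derivative (q 2),
      X * derivative (derivative (q 3)) + (1 - C (s.mu α)) * derivative (q 3)] := by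
  cases s <;> simp [sX, LamCase.idx, LamCase.jdx]

theorem sX_single_jdx (q : Model) : sX α s (Pi.single s.jdx 1) q = ![-q 1, 0, 0, 0] := by
  cases s <;> simp [sX, LamCase.idx, LamCase.jdx]

theorem sX_single_two (q : Model) : sX α s (Pi.single 2 1) q =
    ![2 * (C (s.kap α) * X * derivative (q 3) - C (s.lam α) * q 3), 0, derivative (q 1), 0] := by
  cases s <;> simp [sX, LamCase.idx, LamCase.jdx]

theorem sX_single_three (q : Model) : sX α s (Pi.single 3 1) q =
    ![-(2 * (C (s.kap α) * X * derivative (q 2) - C (s.lam α) * q 2)), 0, 0,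
      derivative (q 1)] := by
  cases s <;> simp [sX, LamCase.idx, LamCase.jdx]

/-- The operator multiplies the coefficient of `X^m` by `2κ(m - μ)`, which is never zero. -/
theorem eq_zero_of_euler (hα : α ≠ 0) (hμ : ∀ n : ℕ, s.mu α ≠ n) {f : Polynomial ℂ}
    (h : 2 * (C (s.kap α) * X * derivative f - C (s.lam α) * f) = 0) : f = 0 := by
  have h' := (mul_eq_zero.1 h).resolve_left two_ne_zero
  ext m
  have hm := congrArg (fun p : Polynomial ℂ => p.coeff m) h'
  simp only [mul_assoc, Polynomial.coeff_sub, Polynomial.coeff_C_mul, coeff_X_mul_derivative,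
    Polynomial.coeff_zero, lam_eq_kap_mul_mu hα] at hm
  have : s.kap α * (m - s.mu α) * f.coeff m = 0 := by linear_combination hm
  exact (mul_eq_zero.1 this).resolve_left
    (mul_ne_zero (kap_ne_zero hα) (sub_ne_zero.2 (hμ m).symm))

/-- Direction `j` kills the second coordinate and the odd directions the last two. Direction `i`
multiplies the coefficient of `X^{m+1}` in the first by `(m - μ)(m + 1)`, so only the constant term
survives. -/
theorem exists_eq_of_sX_eq_zero (hα : α ≠ 0) (hμ : ∀ n : ℕ, s.mu α ≠ n) {q : Model}
    (h : ∀ l, sX α s (Pi.single l 1) q = 0) : ∃ t, q = ![C t, 0, 0, 0] := by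
  have hi := congrFun (sX_single_idx (α := α) q ▸ h s.idx) 0
  have hj := congrFun (sX_single_jdx (α := α) q ▸ h s.jdx) 0
  have h2 := congrFun (sX_single_two (α := α) (s := s) q ▸ h 2) 0
  have h3 := congrFun (sX_single_three (α := α) (s := s) q ▸ h 3) 0
  have h0 : q 0 = C ((q 0).coeff 0) := by
    ext m
    cases m with
    | zero => simp
    | succ m =>
      have hm := congrArg (fun p : Polynomial ℂ => p.coeff m) hi
      simp only [Matrix.cons_val_zero, Polynomial.coeff_sub, Polynomial.coeff_C_mul,
        coeff_X_mul_derivative, Polynomial.coeff_derivative, Pi.zero_apply,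
        Polynomial.coeff_zero] at hm
      have : (m - s.mu α) * (m + 1) * (q 0).coeff (m + 1) = 0 := by linear_combination hm
      rw [Polynomial.coeff_C_succ]
      exact (mul_eq_zero.1 this).resolve_left
        (mul_ne_zero (sub_ne_zero.2 (hμ m).symm) (Nat.cast_add_one_ne_zero m))
  refine ⟨(q 0).coeff 0, ?_⟩
  ext1 i
  fin_cases i
  · exact h0
  · exact neg_eq_zero.1 hj
  · exact eq_zero_of_euler hα hμ (neg_eq_zero.1 h3)
  · exact eq_zero_of_euler hα hμ h2

end Lowering

/-! ### Generation from `1` and descent to `1` -/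

section Generation

open Polynomial (C X)

variable {K : Subfield ℂ} {α : ℂ} {s : LamCase} {N : Submodule ℂ (Fock α s)}

/-- The monomials span the Fock space. -/
theorem eq_top_of_monomial_mem
    (h : ∀ (l : Fin 4) (n : ℕ), ofModel α s (Pi.single l (X ^ n)) ∈ N) : N = ⊤ := by
  have key : ∀ (l : Fin 4) (f : Polynomial ℂ), ofModel α s (Pi.single l f) ∈ N := by
    intro l f
    induction f using Polynomial.induction_on' with
    | add f g hf hg =>
      rw [Pi.single_add, map_add]
      exact N.add_mem hf hg
    | monomial n t =>
      rw [← Polynomial.C_mul_X_pow_eq_monomial, ← Polynomial.smul_eq_C_mul, Pi.single_smul,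
        map_smul]
      exact N.smul_mem t (h l n)
  refine eq_top_iff.2 fun v _ => ?_
  obtain ⟨q, rfl⟩ := (ofModel α s).surjective v
  rw [← Finset.univ_sum_single q, map_sum]
  exact N.sum_mem fun i _ => key i _

/-- Multiplication by `z_i` builds all powers of `z_i`, and one further multiplication reaches the
other coordinates. -/
theorem IsInvariant.eq_top_of_one_mem (hN : IsInvariant (g K α : Set Triple) N) (hαK : α ∈ K)
    (hα : α ≠ 0) (h : ofModel α s ![1, 0, 0, 0] ∈ N) : N = ⊤ := by
  have raise : ∀ (l : Fin 4) {q : Model}, ofModel α s q ∈ N →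
      ofModel α s (sU α s (Pi.single l 1) q) ∈ N := fun l _ hq =>
    (hN.sU_sX_mem hαK hα (single_J_mem l) hq).1
  have h0 : ∀ n : ℕ, ofModel α s ![X ^ n, 0, 0, 0] ∈ N := by
    intro n
    induction n with
    | zero => rwa [pow_zero]
    | succ n ih =>
      convert raise s.idx ih using 2
      ext1 i
      cases s <;> fin_cases i <;> simp [sU, LamCase.idx, LamCase.jdx, pow_succ']
  refine eq_top_of_monomial_mem fun l n => ?_
  fin_cases l
  · convert h0 n using 2
    ext1 i; fin_cases i <;> simp
  · convert raise s.jdx (h0 n) using 2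
    ext1 i
    cases s <;> fin_cases i <;> simp [sU, LamCase.idx, LamCase.jdx]
  · convert raise 2 (h0 n) using 2
    ext1 i
    cases s <;> fin_cases i <;> simp [sU, LamCase.idx, LamCase.jdx]
  · convert raise 3 (h0 n) using 2
    ext1 i
    cases s <;> fin_cases i <;> simp [sU, LamCase.idx, LamCase.jdx]

/-- Induction on the degree: unless the vector is constant, some Bessel operator gives a nonzero
vector of smaller degree bound in `N`. -/
theorem IsInvariant.one_mem (hN : IsInvariant (g K α : Set Triple) N) (hαK : α ∈ K)
    (hα : α ≠ 0) (hμ : ∀ n : ℕ, s.mu α ≠ n) (n : ℕ) : ∀ q : Model, DegreeLE n q → q ≠ 0 →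
      ofModel α s q ∈ N → ofModel α s ![1, 0, 0, 0] ∈ N := by
  have hconst : ∀ t : ℂ, (![C t, 0, 0, 0] : Model) ≠ 0 → ofModel α s ![C t, 0, 0, 0] ∈ N →
      ofModel α s ![1, 0, 0, 0] ∈ N := by
    intro t ht0 ht
    have ht' : t ≠ 0 := by
      rintro rfl
      refine ht0 ?_
      ext1 i; fin_cases i <;> simp
    have e : (![C t, 0, 0, 0] : Model) = t • ![1, 0, 0, 0] := by
      ext1 i; fin_cases i <;> simp [Polynomial.smul_eq_C_mul]
    rw [e, map_smul] at ht
    exact mem_of_smul_mem ht' ht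
  induction n with
  | zero =>
    intro q hq hq0 hqN
    have e : q = ![C ((q 0).coeff 0), 0, 0, 0] := by
      ext1 i
      ext m
      fin_cases i
      · cases m with
        | zero => simp
        | succ m => simpa using (hq (m + 1)).1 (by omega)
      · simpa using ((hq m).2 (Nat.zero_le m)).1
      · simpa using ((hq m).2 (Nat.zero_le m)).2.1
      · simpa using ((hq m).2 (Nat.zero_le m)).2.2
    rw [e] at hq0 hqN
    exact hconst _ hq0 hqN
  | succ n ih =>
    intro q hq hq0 hqN
    by_cases h : ∀ l, sX α s (Pi.single l 1) q = 0
    · obtain ⟨t, rfl⟩ := exists_eq_of_sX_eq_zero hα hμ h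
      exact hconst t hq0 hqN
    · push Not at h
      obtain ⟨l, hl⟩ := h
      exact ih _ (hq.sX _) hl (hN.sU_sX_mem hαK hα (single_J_mem l) hqN).2

theorem IsInvariant.eq_bot_or_eq_top (hN : IsInvariant (g K α : Set Triple) N) (hαK : α ∈ K)
    (hα : α ≠ 0) (hμ : ∀ n : ℕ, s.mu α ≠ n) : N = ⊥ ∨ N = ⊤ := by
  refine or_iff_not_imp_left.2 fun hbot => ?_
  obtain ⟨v, hv, hv0⟩ := (Submodule.ne_bot_iff _).1 hbot
  obtain ⟨q, rfl⟩ := (ofModel α s).surjective v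
  obtain ⟨n, hn⟩ := exists_degreeLE q
  exact hN.eq_top_of_one_mem hαK hα
    (hN.one_mem hαK hα hμ n q hn ((ofModel α s).map_ne_zero_iff.1 hv0) hv)

theorem isInvariant_F (hα : α ≠ 0) : IsInvariant (g K α : Set Triple) (F K α s) := by
  rintro X hX p ⟨_, ⟨A, hA, rfl⟩, h⟩
  refine ⟨rho α (s.lam α) X (A 1),
    ⟨rho α (s.lam α) X * A, Subalgebra.mul_mem _ (Algebra.subset_adjoin ⟨X, hX, rfl⟩) hA, rfl⟩, ?_⟩
  have h' : A 1 - p ∈ idealI α s := (Submodule.Quotient.eq _).1 h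
  refine (Submodule.Quotient.eq _).2 ?_
  rw [← map_sub]
  exact rho_mem_idealI hα hX h'

theorem F_eq_top (hαK : α ∈ K) (hα : α ≠ 0) : F K α s = ⊤ := by
  refine (isInvariant_F hα).eq_top_of_one_mem hαK hα ?_
  rw [← red_one, ofModel_red]
  exact ⟨1, ⟨1, Subalgebra.one_mem _, rfl⟩, rfl⟩

theorem isIrred_F (hαK : α ∈ K) (hα : α ≠ 0) (hμ : ∀ n : ℕ, s.mu α ≠ n) :
    IsIrred (g K α : Set Triple) (F K α s) := by
  refine ⟨⟨?_, isInvariant_F hα⟩, ?_, fun N _ hN => ?_⟩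
  · rw [F_eq_top hαK hα]
    exact isGraded_top
  · rw [F_eq_top hαK hα]
    exact fun h => Fk_zero_ne ((Submodule.eq_bot_iff _).1 h _ trivial)
  · rw [F_eq_top hαK hα]
    exact hN.eq_bot_or_eq_top hαK hα hμ

end Generation

/-! ### The grading by degree -/

section Decomposition

open Polynomial (C X)

variable (α : ℂ) (s : LamCase)

/-- The Euler operator on the polynomial model. -/
def euler : Model →ₗ[ℂ] Model where
  toFun q := ![X * derivative (q 0), X * derivative (q 1) + q 1, X * derivative (q 2) + q 2,
    X * derivative (q 3) + q 3]
  map_add' p q := by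
    ext1 i; fin_cases i <;> simp <;> ring
  map_smul' t q := by
    ext1 i; fin_cases i <;> simp

theorem Fk_le_eigenspace (n : ℕ) :
    Fk α s n ≤ Module.End.eigenspace ((ofModel α s).conj euler) n := by
  cases n with
  | zero =>
    rw [Fk, Submodule.span_singleton_le_iff_mem, ← ofModel_red, red_one,
      Module.End.mem_eigenspace_iff, LinearEquiv.conj_apply_apply, LinearEquiv.symm_apply_apply,
      ← map_smul]
    congr 1
    ext1 i; fin_cases i <;> simp [euler]
  | succ n =>
    rw [Fk_succ]
    rintro _ ⟨x, rfl⟩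
    rw [Module.End.mem_eigenspace_iff, comp_apply, LinearEquiv.conj_apply_apply,
      LinearEquiv.symm_apply_apply, ← map_smul]
    congr 1
    ext1 i
    fin_cases i <;>
      simp only [euler, LinearMap.coe_mk, AddHom.coe_mk, X_mul_derivative_C_mul_X_pow,
        Pi.smul_apply, Polynomial.smul_eq_C_mul, Matrix.cons_val, Fin.zero_eta, Fin.mk_one,
        Fin.reduceFinMk, map_mul, map_natCast, Nat.cast_add, Nat.cast_one, map_add, map_one] <;>
      ring

/-- The components have the distinct Euler eigenvalues `n`. -/
theorem iSupIndep_Fk : iSupIndep (Fk α s) :=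
  ((Module.End.eigenspaces_iSupIndep ((ofModel α s).conj euler)).comp
    (Nat.cast_injective (R := ℂ))).mono (Fk_le_eigenspace α s)

theorem iSup_Fk : ⨆ n, Fk α s n = ⊤ := by
  have hc : ∀ n x, comp α s n x ∈ ⨆ n, Fk α s n := fun n x =>
    Submodule.mem_iSup_of_mem (n + 1) (Fk_succ α s n ▸ ⟨x, rfl⟩)
  have hs : ∀ (l : Fin 4) (n : ℕ), l ≠ 0 →
      ofModel α s (Pi.single l (X ^ n)) ∈ ⨆ n, Fk α s n := by
    intro l n hl
    convert hc n (Pi.single l 1) using 1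
    rw [comp_apply]
    congr 1
    ext1 i
    fin_cases l <;> fin_cases i <;> simp at hl ⊢
  refine eq_top_of_monomial_mem fun l n => ?_
  by_cases hl : l = 0
  · subst hl
    cases n with
    | zero =>
      refine Submodule.mem_iSup_of_mem 0 (Submodule.mem_span_singleton.2 ⟨1, ?_⟩)
      rw [one_smul, ← ofModel_red, red_one]
      congr 1
      ext1 i; fin_cases i <;> simp
    | succ n =>
      convert hc n (Pi.single 0 1) using 1
      rw [comp_apply]
      congr 1
      ext1 i
      fin_cases i <;> simp
  · exact hs l n hl

end Decomposition

end

end FockD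

end

open FockD

theorem mainTheorem1 (K : Subfield ℂ) (α : ℂ) (hαK : α ∈ K) (hα : α ≠ 0) (s : LamCase)
    (hs : (s = LamCase.alpha ∧ ∀ n : ℕ, α ≠ n) ∨ (s = LamCase.one ∧ ∀ n : ℕ, α⁻¹ ≠ n)) :
    -- `ρ_λ` is a representation of the Lie superalgebra `𝔤`, and `I_λ` is a submodule
    (∀ X ∈ g K α, ∀ Y ∈ g K α, bracket α X Y ∈ g K α) ∧
    (∀ p q : Fin 2, ∀ X ∈ g K α, ∀ Y ∈ g K α, HasParity p X → HasParity q Y →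
      rho α (s.lam α) (bracket α X Y) =
        rho α (s.lam α) X * rho α (s.lam α) Y
          - ((-1 : ℂ) ^ ((p : ℕ) * (q : ℕ))) • (rho α (s.lam α) Y * rho α (s.lam α) X)) ∧
    (∀ X ∈ g K α, idealI α s ≤ (idealI α s).comap (rho α (s.lam α) X)) ∧
    -- the decomposition over `𝔨₀` for `α ≠ -1`
    (α ≠ -1 → ∀ n : ℕ, 1 ≤ n →
      IsIrred (k₀ K α) (Hk α s n) ∧ IsIrred (k₀ K α) (line α s n) ∧
      Hk α s n ⊓ line α s n = ⊥ ∧ Hk α s n ⊔ line α s n = Fk α s n) ∧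
    -- for `α = -1`: indecomposable, but not irreducible, over `𝔨₀`
    (α = -1 → ∀ n : ℕ, 1 ≤ n →
      IsIndecomp (k₀ K α) (Fk α s n) ∧
      ∃ N : Submodule ℂ (Fock α s), IsSubmod (k₀ K α) N ∧ ⊥ < N ∧ N < Fk α s n) ∧
    -- irreducibility over `𝔨`
    (∀ n : ℕ, IsIrred (k K α) (Fk α s n)) ∧
    -- irreducibility over `𝔤`, and the `𝔨`-type decomposition
    F K α s = ⊤ ∧
    IsIrred (g K α : Set Triple) (F K α s) ∧
    iSupIndep (Fk α s) ∧ (⨆ n, Fk α s n) = F K α s := by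
  -- Both cases of the hypothesis become the single condition `μ ∉ ℕ`.
  have hμ : ∀ n : ℕ, s.mu α ≠ n := by
    rcases hs with ⟨rfl, h⟩ | ⟨rfl, h⟩ <;> exact h
  refine ⟨fun X hX Y hY => bracket_mem_g hαK hX hY, fun p q X hX Y hY hp hq => ?_,
    fun X hX p hp => rho_mem_idealI hα hX hp, fun h1 n hn => ?_, fun h1 n hn => ?_, fun n => ?_,
    F_eq_top hαK hα, isIrred_F hαK hα hμ, iSupIndep_Fk α s,
    (iSup_Fk α s).trans (F_eq_top hαK hα).symm⟩
  · rw [LamCase.lam_eq hα s]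
    exact rho_bracket hα (s.nu α) hX hY hp hq
  · obtain ⟨m, rfl⟩ := Nat.exists_eq_add_of_le' hn
    exact ⟨isIrred_Hk hαK hα h1 m, isIrred_line hα m, Hk_inf_line h1 m, Hk_sup_line h1 m⟩
  · obtain ⟨m, rfl⟩ := Nat.exists_eq_add_of_le' hn
    exact ⟨isIndecomp_Fk hαK hα h1 m, exists_submod_Fk hα m⟩
  · cases n with
    | zero => exact isIrred_Fk_zero hα
    | succ m => exact isIrred_Fk_succ hαK hα hμ m
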